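/- Let $(X,\mu)$ be a $\sigma$-finite measure space (for instance $\mathbb N$ with counting measure or $\mathbb R^d$ with Lebesgue measure), $\mathfrak h=L^2(X,\mu)$, let $\mathscr F_-=\bigoplus_{N\ge 0}S_-\mathfrak h^{\otimes N}$ be the fermionic Fock space ($S_-$ the antisymmetrizer, $\mathfrak h^{\otimes N}=L^2(X^N)$), and let $\mathscr F_{\rm fin}\subset\mathscr F_-$ be the space of vectors with finitely many nonzero sectors. Let $a^*(f)\psi=\sqrt{N+1}\,S_-(f\otimes\psi)$ for $\psi\in S_-\mathfrak h^{\otimes N}$, and let $a(f)$ be the adjoint, so that the CAR hold; formally $a^*(f)=\int f(x)a^*_x\,dx$ and $a(f)=\int\overline{f(x)}a_x\,dx$. For $f\in L^2(X^n\times X^m)$ let $$D^{(n,m)}(f)=\int f(X,Y)\,a^*_{x_n}\cdots a^*_{x_1}a_{y_1}\cdots a_{y_m}\,dX\,dY:\ \mathscr F_{\rm fin}\to\mathscr F_{\rm fin},$$ that is, $D^{(n,m)}(f)$ maps the $(m+k)$-particle component $\psi$ ($k\ge 0$) to the $(n+k)$-particle vector $$\sqrt{\tfrac{(n+k)!}{k!}\tfrac{(m+k)!}{k!}}\;S_-\Phi,\qquad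 \Phi(x_n,\dots,x_1,z)=\int f(X,Y)\,\psi(y_m,\dots,y_1,z)\,dY ,$$ and components with fewer than $m$ particles to $0$. Let $A=D^{(n_A,m_A)}(f_A)$ and $B=D^{(n_B,m_B)}(f_B)$ with $n_A,m_A,n_B,m_B\ge 0$ and $L^2$ kernels $f_A,f_B$. Let $\mathcal C$ be the finite set of all pairs $(\pi,\pi')$ such that, for some $1\le C\le\min(m_A,n_B)$, $\pi:\{1,\dots,C\}\to\{1,\dots,n_B\}$ is strictly decreasing and $\pi':\{1,\dots,C\}\to\{1,\dots,m_A\}$ is injective. Let $\mathcal U=\{1,\dots,n_B\}\setminus\operatorname{im}\pi$ and $\mathcal U'=\{1,\dots,m_A\}\setminus\operatorname{im}\pi'$. Let $\sigma$ be the permutation of $\{1,\dots,n_B\}$ with $\sigma(\pi(c))=n_B-c+1$ for all $c$ that is increasing on $\mathcal U$, let $\sigma'$ be the permutation of $\{1,\dots,m_A\}$ with $\sigma'(\pi'(c))=m_A-c+1$ for all $c$ that is increasing on $\mathcal U'$, and put $$\operatorname{sgn}(\pi,\pi')=(-1)^{(m_A-C)(n_B-C)}\operatorname{sgn}(\sigma)\operatorname{sgn}(\sigma').$$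 The fermionic attached product is $$A\circ_F B=\sum_{(\pi,\pi')\in\mathcal C}\operatorname{sgn}(\pi,\pi')\int f_A(X_A,Y_A)f_B(X_B,Y_B)\prod_{c=1}^C\delta(x_{B,\pi(c)}-y_{A,\pi'(c)})\Big(\prod_{\ell=1}^{n_A}a_{x_{A,\ell}}\Big)^{*}\Big(\prod_{u\in\mathcal U}a_{x_{B,u}}\Big)^{*}\prod_{u'\in\mathcal U'}a_{y_{A,u'}}\prod_{\ell'=1}^{m_B}a_{y_{B,\ell'}},$$ where products are ordered by increasing index, the integral is over all variables, and each summand is the operator $D^{(n_A+n_B-C,\;m_A+m_B-C)}$ of the $L^2$ kernel obtained by integrating out the contracted variables, its remaining variables being numbered in the order given by the operator product. Then, on $\mathscr F_{\rm fin}$, $$AB-BA=A\circ_F B-B\circ_F A\quad\text{if }(n_A+m_A)(n_B+m_B)\text{ is even},$$ $$AB+BA=A\circ_F B+B\circ_F A\quad\text{if }(n_A+m_A)(n_B+m_B)\text{ is odd}.$$ -/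

import Mathlib

open MeasureTheory
open scoped ENNReal

noncomputable section

namespace FermionFock

/-! ### Composition of square-integrable kernels -/

section Kernel
variable {a b c : Type*} [MeasurableSpace a] [MeasurableSpace b] [MeasurableSpace c]
  {μa : Measure a} {μb : Measure b} {μc : Measure c} [SigmaFinite μb] [SigmaFinite μc]

theorem lintegral_section_lt_top {F : a × c → ℂ} (hF : MemLp F 2 (μa.prod μc)) :
    AEMeasurable (fun x => ∫⁻ w, ‖F (x, w)‖ₑ ^ (2 : ℝ) ∂μc) μa ∧
      ∫⁻ x, ∫⁻ w, ‖F (x, w)‖ₑ ^ (2 : ℝ) ∂μc ∂μa < ∞ := by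
  refine ⟨(hF.1.enorm.pow_const 2).lintegral_prod_right', ?_⟩
  rw [← lintegral_prod _ (hF.1.enorm.pow_const 2)]
  simpa using (eLpNorm_lt_top_iff_lintegral_rpow_enorm_lt_top (by norm_num) (by norm_num)).1 hF.2

theorem ae_memLp_section {F : a × c → ℂ} (hF : MemLp F 2 (μa.prod μc)) :
    ∀ᵐ x ∂μa, MemLp (fun w => F (x, w)) 2 μc := by
  obtain ⟨h1, h2⟩ := lintegral_section_lt_top hF
  filter_upwards [hF.1.prodMk_left, ae_lt_top' h1 h2.ne] with x hx hx3
  exact ⟨hx, (eLpNorm_lt_top_iff_lintegral_rpow_enorm_lt_top (by norm_num) (by norm_num)).2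
    (by simpa using hx3)⟩

theorem memLp_swap {G : c × b → ℂ} (hG : MemLp G 2 (μc.prod μb)) :
    MemLp (fun p : b × c => G (p.2, p.1)) 2 (μb.prod μc) :=
  hG.comp_measurePreserving Measure.measurePreserving_swap

theorem memLp_kernel_comp [SigmaFinite μa] {F : a × c → ℂ} {G : c × b → ℂ}
    (hF : MemLp F 2 (μa.prod μc)) (hG : MemLp G 2 (μc.prod μb)) :
    MemLp (fun p : a × b => ∫ w, F (p.1, w) * G (w, p.2) ∂μc) 2 (μa.prod μb) := by
  have hG' := memLp_swap hG
  have e1 : AEStronglyMeasurable (fun q : (a × b) × c => F (q.1.1, q.2)) ((μa.prod μb).prod μc) :=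
    hF.1.comp_quasiMeasurePreserving
      (QuasiMeasurePreserving.prodMap Measure.quasiMeasurePreserving_fst (.id μc))
  have e2 : AEStronglyMeasurable (fun q : (a × b) × c => G (q.2, q.1.2)) ((μa.prod μb).prod μc) :=
    hG'.1.comp_quasiMeasurePreserving
      (QuasiMeasurePreserving.prodMap Measure.quasiMeasurePreserving_snd (.id μc))
  refine ⟨(e1.mul e2).integral_prod_right', ?_⟩
  rw [eLpNorm_lt_top_iff_lintegral_rpow_enorm_lt_top (by norm_num) (by norm_num)]
  obtain ⟨m1, f1⟩ := lintegral_section_lt_top hF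
  obtain ⟨m2, f2⟩ := lintegral_section_lt_top hG'
  have key : ∀ᵐ p ∂(μa.prod μb), ‖∫ w, F (p.1, w) * G (w, p.2) ∂μc‖ₑ ^ (2 : ℝ) ≤
      (∫⁻ w, ‖F (p.1, w)‖ₑ ^ (2 : ℝ) ∂μc) * ∫⁻ w, ‖G (w, p.2)‖ₑ ^ (2 : ℝ) ∂μc := by
    filter_upwards [e1.prodMk_left, e2.prodMk_left] with p h1 h2
    have := ENNReal.lintegral_mul_le_Lp_mul_Lq μc Real.HolderConjugate.two_two h1.enorm h2.enorm
    calc _ ≤ (∫⁻ w, ‖F (p.1, w)‖ₑ * ‖G (w, p.2)‖ₑ ∂μc) ^ (2 : ℝ) := by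
            gcongr
            refine (enorm_integral_le_lintegral_enorm _).trans (le_of_eq ?_)
            simp [enorm_mul]
      _ ≤ _ := by
            refine (ENNReal.rpow_le_rpow this (by norm_num)).trans (le_of_eq ?_)
            rw [ENNReal.mul_rpow_of_nonneg _ _ (by norm_num), ← ENNReal.rpow_mul,
              ← ENNReal.rpow_mul]
            simp
  calc _ ≤ ∫⁻ p, (∫⁻ w, ‖F (p.1, w)‖ₑ ^ (2 : ℝ) ∂μc) * (∫⁻ w, ‖G (w, p.2)‖ₑ ^ (2 : ℝ) ∂μc)
        ∂(μa.prod μb) := lintegral_mono_ae (by simpa using key)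
    _ = _ := lintegral_prod_mul m1 m2
    _ < ∞ := ENNReal.mul_lt_top f1 f2

theorem ae_integrable_kernel {F : a × c → ℂ} {G : c × b → ℂ}
    (hF : MemLp F 2 (μa.prod μc)) (hG : MemLp G 2 (μc.prod μb)) :
    ∀ᵐ p ∂(μa.prod μb), Integrable (fun w => F (p.1, w) * G (w, p.2)) μc := by
  have h1 := Measure.quasiMeasurePreserving_fst.ae (μa := μa.prod μb) (ae_memLp_section hF)
  have h2 := Measure.quasiMeasurePreserving_snd.ae (μa := μa.prod μb) (ae_memLp_section (memLp_swap hG))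
  filter_upwards [h1, h2] with p h1 h2
  exact h1.integrable_mul h2

end Kernel

/-! ### `L²(X^ι)`, relabelling of variables, contraction of variables -/

section L2
variable {X : Type*} [MeasurableSpace X] (μ : Measure X) [SigmaFinite μ]

/-- `L²(X^ι, μ^ι)` for a finite index set `ι`. The one-particle space is `𝔥 = L²(X, μ)`, and the
Hilbert tensor power `𝔥^{⊗ι}` is identified with `L²(X^ι)` in the usual way. -/
abbrev L2 (ι : Type*) [Fintype ι] : Type _ := Lp ℂ 2 (Measure.pi fun _ : ι => μ)

theorem measurePreserving_reindex {ι κ : Type*} [Fintype ι] [Fintype κ] (e : ι ≃ κ) :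
    MeasurePreserving (fun (x : κ → X) (i : ι) => x (e i))
      (Measure.pi fun _ : κ => μ) (Measure.pi fun _ : ι => μ) :=
  (measurePreserving_piCongrLeft (fun _ : κ => μ) e).symm

/-- Relabelling of variables along `e : ι ≃ κ`: `(reindex e ψ)(x) = ψ((x_{e i})_{i ∈ ι})`. -/
def reindex {ι κ : Type*} [Fintype ι] [Fintype κ] (e : ι ≃ κ) : L2 μ ι →ₗ[ℂ] L2 μ κ :=
  Lp.compMeasurePreservingₗ ℂ (fun (x : κ → X) (i : ι) => x (e i)) (measurePreserving_reindex μ e)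

theorem coeFn_reindex {ι κ : Type*} [Fintype ι] [Fintype κ] (e : ι ≃ κ) (ψ : L2 μ ι) :
    reindex μ e ψ =ᵐ[Measure.pi fun _ : κ => μ] fun x => ψ (fun i => x (e i)) :=
  Lp.coeFn_compMeasurePreserving ψ (measurePreserving_reindex μ e)

theorem measurePreserving_sumElim (ι κ : Type*) [Fintype ι] [Fintype κ] :
    MeasurePreserving (fun p : (ι → X) × (κ → X) => (Sum.elim p.1 p.2 : ι ⊕ κ → X))
      ((Measure.pi fun _ => μ).prod (Measure.pi fun _ => μ)) (Measure.pi fun _ => μ) := by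
  convert measurePreserving_sumPiEquivProdPi_symm (fun _ : ι ⊕ κ => μ) using 1
  ext p i
  cases i <;> rfl

theorem measurePreserving_sumSplit (ι κ : Type*) [Fintype ι] [Fintype κ] :
    MeasurePreserving (fun x : ι ⊕ κ → X => ((fun i => x (.inl i)), (fun k => x (.inr k))))
      (Measure.pi fun _ => μ) ((Measure.pi fun _ => μ).prod (Measure.pi fun _ => μ)) :=
  measurePreserving_sumPiEquivProdPi (fun _ : ι ⊕ κ => μ)

/-- `(x, y) ↦ ∫ F(x, w) G(w, y) dw`, with `w` running over `X^γ`: the variables of `F` and of `G`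
with index in `γ` are identified by delta functions and integrated. -/
def contractFun {α β γ : Type*} [Fintype γ] (F : (α ⊕ γ → X) → ℂ) (G : (γ ⊕ β → X) → ℂ)
    (z : α ⊕ β → X) : ℂ :=
  ∫ w : γ → X, F (Sum.elim (fun i => z (.inl i)) w) * G (Sum.elim w (fun j => z (.inr j)))
    ∂(Measure.pi fun _ => μ)

theorem memLp_contractFun {α β γ : Type*} [Fintype α] [Fintype β] [Fintype γ]
    {F : (α ⊕ γ → X) → ℂ} {G : (γ ⊕ β → X) → ℂ}
    (hF : MemLp F 2 (Measure.pi fun _ => μ)) (hG : MemLp G 2 (Measure.pi fun _ => μ)) :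
    MemLp (contractFun μ F G) 2 (Measure.pi fun _ : α ⊕ β => μ) :=
  (memLp_kernel_comp (hF.comp_measurePreserving (measurePreserving_sumElim μ α γ))
    (hG.comp_measurePreserving (measurePreserving_sumElim μ γ β))).comp_measurePreserving
    (measurePreserving_sumSplit μ α β)

theorem ae_integrable_contract {α β γ : Type*} [Fintype α] [Fintype β] [Fintype γ]
    {F : (α ⊕ γ → X) → ℂ} {G : (γ ⊕ β → X) → ℂ}
    (hF : MemLp F 2 (Measure.pi fun _ => μ)) (hG : MemLp G 2 (Measure.pi fun _ => μ)) :
    ∀ᵐ z ∂(Measure.pi fun _ : α ⊕ β => μ), Integrable (fun w : γ → X =>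
      F (Sum.elim (fun i => z (.inl i)) w) * G (Sum.elim w (fun j => z (.inr j))))
        (Measure.pi fun _ => μ) :=
  (measurePreserving_sumSplit μ α β).quasiMeasurePreserving.ae
    (ae_integrable_kernel (hF.comp_measurePreserving (measurePreserving_sumElim μ α γ))
    (hG.comp_measurePreserving (measurePreserving_sumElim μ γ β)))

theorem contractFun_congr {α β γ : Type*} [Fintype α] [Fintype β] [Fintype γ]
    {F F' : (α ⊕ γ → X) → ℂ} {G G' : (γ ⊕ β → X) → ℂ}
    (hF : F =ᵐ[Measure.pi fun _ => μ] F') (hG : G =ᵐ[Measure.pi fun _ => μ] G') :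
    contractFun μ F G =ᵐ[Measure.pi fun _ : α ⊕ β => μ] contractFun μ F' G' := by
  have h1 := (Measure.ae_ae_of_ae_prod
    ((measurePreserving_sumElim μ α γ).quasiMeasurePreserving.ae hF))
  have h2 := Measure.ae_ae_of_ae_prod (Measure.measurePreserving_swap.quasiMeasurePreserving.ae
    ((measurePreserving_sumElim μ γ β).quasiMeasurePreserving.ae hG))
  have h3 := (measurePreserving_sumSplit μ α β).quasiMeasurePreserving.ae
    (Measure.quasiMeasurePreserving_fst.ae h1)
  have h4 := (measurePreserving_sumSplit μ α β).quasiMeasurePreserving.ae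
    (Measure.quasiMeasurePreserving_snd.ae h2)
  filter_upwards [h3, h4] with z h3 h4
  refine integral_congr_ae ?_
  filter_upwards [h3, h4] with w h3 h4
  simp only [Prod.swap] at h3 h4
  rw [h3, h4]

/-- The bilinear contraction `(F, G) ↦ ∫ F(·, w) G(w, ·) dw` on `L²`. -/
def contract {α β γ : Type*} [Fintype α] [Fintype β] [Fintype γ] :
    L2 μ (α ⊕ γ) →ₗ[ℂ] L2 μ (γ ⊕ β) →ₗ[ℂ] L2 μ (α ⊕ β) :=
  LinearMap.mk₂ ℂ
    (fun F G => (memLp_contractFun μ (Lp.memLp F) (Lp.memLp G)).toLp (contractFun μ F G))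
    (by
      intro F F' G
      rw [← MemLp.toLp_add, MemLp.toLp_eq_toLp_iff]
      refine (contractFun_congr μ (Lp.coeFn_add F F') .rfl).trans ?_
      filter_upwards [ae_integrable_contract μ (Lp.memLp F) (Lp.memLp G),
        ae_integrable_contract μ (Lp.memLp F') (Lp.memLp G)] with z h h'
      simp only [contractFun, Pi.add_apply, add_mul]
      exact integral_add h h')
    (by
      intro c F G
      rw [← MemLp.toLp_const_smul, MemLp.toLp_eq_toLp_iff]
      refine (contractFun_congr μ (Lp.coeFn_smul c F) .rfl).trans (.of_forall fun z => ?_)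
      simp only [contractFun, Pi.smul_apply, smul_eq_mul, mul_assoc]
      exact integral_const_mul _ _)
    (by
      intro F G G'
      rw [← MemLp.toLp_add, MemLp.toLp_eq_toLp_iff]
      refine (contractFun_congr μ .rfl (Lp.coeFn_add G G')).trans ?_
      filter_upwards [ae_integrable_contract μ (Lp.memLp F) (Lp.memLp G),
        ae_integrable_contract μ (Lp.memLp F) (Lp.memLp G')] with z h h'
      simp only [contractFun, Pi.add_apply, mul_add]
      exact integral_add h h')
    (by
      intro c F G
      rw [← MemLp.toLp_const_smul, MemLp.toLp_eq_toLp_iff]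
      refine (contractFun_congr μ .rfl (Lp.coeFn_smul c G)).trans (.of_forall fun z => ?_)
      simp only [contractFun, Pi.smul_apply, smul_eq_mul, mul_left_comm _ c]
      exact integral_const_mul _ _)

theorem coeFn_contract {α β γ : Type*} [Fintype α] [Fintype β] [Fintype γ]
    (F : L2 μ (α ⊕ γ)) (G : L2 μ (γ ⊕ β)) :
    contract μ F G =ᵐ[Measure.pi fun _ : α ⊕ β => μ] contractFun μ F G :=
  MemLp.coeFn_toLp (memLp_contractFun μ (Lp.memLp F) (Lp.memLp G))
/-! ### Fermionic Fock space -/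

/-- The antisymmetrization `S₋ = (1/N!) ∑_τ sgn(τ) τ` on `𝔥^{⊗N} = L²(X^N)`. -/
def antisymmetrizer (N : ℕ) : L2 μ (Fin N) →ₗ[ℂ] L2 μ (Fin N) :=
  ((N.factorial : ℂ)⁻¹) • ∑ τ : Equiv.Perm (Fin N), ((Equiv.Perm.sign τ : ℤ) : ℂ) • reindex μ τ

/-- The `N`-particle space `S₋ 𝔥^{⊗N}`. -/
abbrev fermionSector (N : ℕ) : Submodule ℂ (L2 μ (Fin N)) := LinearMap.range (antisymmetrizer μ N)

/-- The fermionic Fock space: the Hilbert direct sum of all `S₋ 𝔥^{⊗N}`. -/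
abbrev Fock : Type _ := lp (fun N : ℕ => fermionSector μ N) 2

/-- The finite-particle space: Fock vectors with only finitely many nonzero sectors. -/
def finiteParticle : Submodule ℂ (Fock μ) where
  carrier := {Ψ | ∃ M : ℕ, ∀ N, M < N → Ψ N = 0}
  add_mem' := by
    rintro Ψ Φ ⟨M, hM⟩ ⟨M', hM'⟩
    refine ⟨max M M', fun N hN => ?_⟩
    simp [hM N (lt_of_le_of_lt (le_max_left _ _) hN), hM' N (lt_of_le_of_lt (le_max_right _ _) hN)]
  zero_mem' := ⟨0, fun N _ => by simp⟩
  smul_mem' := by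
    rintro c Ψ ⟨M, hM⟩
    exact ⟨M, fun N hN => by simp [hM N hN]⟩

/-! ### Normal ordered operators -/

/-- The first `n` of `N = n + k` variables in reversed order, then the other `k` ones in order:
position `n - 1 - j` (counted from `0`) carries the `j`-th of the `n` distinguished variables. -/
def revFirst {n k N : ℕ} (h : n + k = N) : Fin n ⊕ Fin k ≃ Fin N :=
  (Fin.revPerm.sumCongr (Equiv.refl (Fin k))).trans (finSumFinEquiv.trans (finCongr h))

/-- `(Y, z) ↦ (a_{y_1} ⋯ a_{y_m} ψ)(z) = √(N (N-1) ⋯ (N-m+1)) ψ(y_m, …, y_1, z)` for an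
`N`-particle vector `ψ`. This is the `m`-fold iterate of `(a_y ψ)(z) = √N ψ(y, z)`, that is, of
`(a(g) ψ)(z) = √N ∫ conj(g(y)) ψ(y, z) dy`, the adjoint of `a*(g)`. -/
def annihilators {m k N : ℕ} (h : m + k = N) : fermionSector μ N →ₗ[ℂ] L2 μ (Fin m ⊕ Fin k) :=
  ((√(N.descFactorial m) : ℝ) : ℂ) •
    (reindex μ (revFirst h).symm ∘ₗ (fermionSector μ N).subtype)

/-- `φ ↦ ∫ a*_{x_n} ⋯ a*_{x_1} φ(X, ·) dX = √(N (N-1) ⋯ (N-n+1)) S₋ φ̃` with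
`φ̃(x_n, …, x_1, z) = φ(x_1, …, x_n, z)` and `N = n + k`. This is the `n`-fold iterate of
`a*(f) ψ = √(N+1) S₋(f ⊗ ψ)` on `N`-particle vectors, as `S₋(f ⊗ S₋ φ) = S₋(f ⊗ φ)`. -/
def creators {n k N : ℕ} (h : n + k = N) : L2 μ (Fin n ⊕ Fin k) →ₗ[ℂ] fermionSector μ N :=
  ((√(N.descFactorial n) : ℝ) : ℂ) •
    ((antisymmetrizer μ N).rangeRestrict ∘ₗ reindex μ (revFirst h))

/-- The `N`-particle component of a finite-particle vector. -/
def sector (N : ℕ) : finiteParticle μ →ₗ[ℂ] fermionSector μ N where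
  toFun Ψ := (Ψ : Fock μ) N
  map_add' _ _ := rfl
  map_smul' _ _ := rfl

/-- The `N`-particle component of `A Ψ`, where
`A = ∫ f(X, Y) a*_{x_n} ⋯ a*_{x_1} a_{y_1} ⋯ a_{y_m} dX dY`. With `k = N - n`, it is obtained from
the `(m + k)`-particle component of `Ψ`: annihilate, integrate against `f` in `Y`, create. It is
zero for `N < n`. -/
def normalOrderedSector {n m : ℕ} (f : L2 μ (Fin n ⊕ Fin m)) (N : ℕ) :
    finiteParticle μ →ₗ[ℂ] fermionSector μ N :=
  if h : n ≤ N then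
    creators μ (Nat.add_sub_of_le h) ∘ₗ contract μ f ∘ₗ annihilators μ rfl ∘ₗ
      sector μ (m + (N - n))
  else 0

theorem normalOrderedSector_eventually_zero {n m : ℕ} (f : L2 μ (Fin n ⊕ Fin m))
    (Ψ : finiteParticle μ) : ∃ M : ℕ, ∀ N, M < N → normalOrderedSector μ f N Ψ = 0 := by
  obtain ⟨M, hM⟩ := Ψ.2
  refine ⟨n + M, fun N hN => ?_⟩
  have h0 : sector μ (m + (N - n)) Ψ = 0 := hM _ (by omega)
  simp [normalOrderedSector, show n ≤ N by omega, h0]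

/-- The normal ordered operator
`D^{(n,m)}(f) = ∫ f(X, Y) a*_{x_n} ⋯ a*_{x_1} a_{y_1} ⋯ a_{y_m} dX dY` with kernel
`f ∈ L²(X^n × X^m)`, as a linear operator on the finite-particle space. On
`f = f_1 ⊗ ⋯ ⊗ f_n ⊗ conj(g_1) ⊗ ⋯ ⊗ conj(g_m)` it is `a*(f_n) ⋯ a*(f_1) a(g_1) ⋯ a(g_m)`. -/
def normalOrdered {n m : ℕ} (f : L2 μ (Fin n ⊕ Fin m)) : Module.End ℂ (finiteParticle μ) where
  toFun Ψ := ⟨⟨fun N => normalOrderedSector μ f N Ψ, by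
      obtain ⟨M, hM⟩ := normalOrderedSector_eventually_zero μ f Ψ
      refine (memℓp_zero ((Set.finite_Iic M).subset fun N hN => ?_)).of_exponent_ge zero_le
      by_contra h
      exact hN (hM N (by simpa using h))⟩,
    normalOrderedSector_eventually_zero μ f Ψ⟩
  map_add' Ψ Φ := Subtype.ext (lp.ext (funext fun N => map_add (normalOrderedSector μ f N) Ψ Φ))
  map_smul' c Ψ := Subtype.ext (lp.ext (funext fun N => map_smul (normalOrderedSector μ f N) c Ψ))

end L2

/-! ### Contraction configurations and their signs

A contraction of `C` legs picks out of `n` connectors the `C` pairwise different ones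
`p 0, …, p (C - 1)`. All indices are counted from `0`. -/

section Configurations

/-- The connectors that are not contracted. -/
def uncontracted {C n : ℕ} (p : Fin C → Fin n) : Finset (Fin n) :=
  (Finset.univ.image p)ᶜ

theorem card_uncontracted {C n : ℕ} (p : Fin C → Fin n) (hp : Function.Injective p) :
    (uncontracted p).card = n - C := by
  rw [uncontracted, Finset.card_compl, Finset.card_image_of_injective _ hp]
  simp

/-- All connectors: first the uncontracted ones in increasing order, then the contracted ones in
the order of contraction. -/
def legSplit {C n : ℕ} (p : Fin C ↪ Fin n) : Fin (n - C) ⊕ Fin C ≃ Fin n :=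
  Equiv.ofBijective
    (Sum.elim ((uncontracted p).orderEmbOfFin (card_uncontracted p p.injective)) p) (by
      have hC : C ≤ n := by simpa using Fintype.card_le_of_embedding p
      rw [Fintype.bijective_iff_injective_and_card]
      refine ⟨?_, by simp; omega⟩
      refine (RelEmbedding.injective _).sumElim p.injective fun i c h => ?_
      have := Finset.orderEmbOfFin_mem (uncontracted p) (card_uncontracted p p.injective) i
      rw [h] at this
      simp [uncontracted] at this)

/-- The contraction that occurs on either side of a maximally crossed diagram: the `c`-th contracted
connector is the `c`-th last of all connectors. -/
def maximalCrossing {C n : ℕ} (h : C ≤ n) : Fin C ↪ Fin n :=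
  (Fin.castLEEmb h).trans Fin.revPerm.toEmbedding

/-- The permutation that takes the connectors into maximally crossed form, and preserves the order
of the uncontracted ones. It is determined by the two properties proved below. -/
def crossingPerm {C n : ℕ} (p : Fin C ↪ Fin n) : Equiv.Perm (Fin n) :=
  (legSplit p).symm.trans
    (legSplit (maximalCrossing (by simpa using Fintype.card_le_of_embedding p)))

theorem crossingPerm_contracted {C n : ℕ} (p : Fin C ↪ Fin n) (c : Fin C) :
    (crossingPerm p (p c) : ℕ) = n - 1 - c := by
  have : p c = legSplit p (Sum.inr c) := rfl
  rw [crossingPerm, Equiv.trans_apply, this, Equiv.symm_apply_apply]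
  simp [legSplit, maximalCrossing, Fin.val_rev]
  omega

theorem crossingPerm_uncontracted {C n : ℕ} (p : Fin C ↪ Fin n) :
    StrictMonoOn (crossingPerm p) (uncontracted p) := by
  intro u hu v hv huv
  have key : ∀ w ∈ uncontracted p, ∃ i, w = legSplit p (Sum.inl i) := by
    intro w hw
    obtain ⟨i | c, hi⟩ := (legSplit p).surjective w
    · exact ⟨i, hi.symm⟩
    · exact absurd hw (by simp [uncontracted, ← hi, legSplit])
  obtain ⟨i, rfl⟩ := key u hu
  obtain ⟨j, rfl⟩ := key v hv
  have hij : i < j := by simpa [legSplit] using huv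
  rw [crossingPerm, Equiv.trans_apply, Equiv.trans_apply, Equiv.symm_apply_apply,
    Equiv.symm_apply_apply]
  simpa [legSplit] using hij

end Configurations

/-! ### The fermionic attached product -/

section Product
variable {X : Type*} [MeasurableSpace X] (μ : Measure X) [SigmaFinite μ]

/-- The kernel of the contribution of a configuration to the attached product: `x_{B, p c}` and
`y_{A, p' c}` are identified and integrated for all `c`. The remaining variables are ordered as in
`(∏_{ℓ ≤ nA} a_{A,ℓ})* (∏_{u ∈ U} a_u)* ∏_{u' ∈ U'} a_{u'} ∏_{ℓ' ≤ mB} a_{B,ℓ'}`, where `U`, `U'`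
are the sets of uncontracted connectors among the `x_B`, `y_A`. So, in the convention of
`normalOrdered`, the creation variables are `(x_u)_{u ∈ U}, x_{A,1}, …, x_{A,nA}`, and the
annihilation variables are `(y_u')_{u' ∈ U'}, y_{B,1}, …, y_{B,mB}`. -/
def contractedKernel {nA mA nB mB C : ℕ} (fA : L2 μ (Fin nA ⊕ Fin mA)) (fB : L2 μ (Fin nB ⊕ Fin mB))
    (p : Fin C ↪ Fin nB) (p' : Fin C ↪ Fin mA) :
    L2 μ (Fin ((nB - C) + nA) ⊕ Fin ((mA - C) + mB)) :=
  reindex μ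
    ((Equiv.sumSumSumComm (Fin nA) (Fin (mA - C)) (Fin (nB - C)) (Fin mB)).trans
      (((Equiv.sumComm _ _).trans finSumFinEquiv).sumCongr finSumFinEquiv))
    (contract μ
      (reindex μ (((Equiv.refl (Fin nA)).sumCongr (legSplit p').symm).trans
        (Equiv.sumAssoc _ _ _).symm) fA)
      (reindex μ ((((legSplit p).symm.trans (Equiv.sumComm _ _)).sumCongr
        (Equiv.refl (Fin mB))).trans (Equiv.sumAssoc _ _ _)) fB))

/-- The sign of a configuration: `(-1)^((m - C)(n - C)) sgn(σ) sgn(σ')`, where `σ`, `σ'` are the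
permutations to the maximally crossed form. -/
def contractionSign {m n C : ℕ} (p : Fin C ↪ Fin n) (p' : Fin C ↪ Fin m) : ℤ :=
  (-1) ^ ((m - C) * (n - C)) * Equiv.Perm.sign (crossingPerm p) * Equiv.Perm.sign (crossingPerm p')

open Classical in
/-- The fermionic attached product of the normal ordered operators with kernels `fA`, `fB`: the
signed sum over all configurations, which contract `1 ≤ C ≤ min(mA, nB)` right connectors `p' c` of
`A` with left connectors `p c` of `B`, with `p` strictly decreasing and `p'` injective. -/
def attachedProduct {nA mA nB mB : ℕ} (fA : L2 μ (Fin nA ⊕ Fin mA)) (fB : L2 μ (Fin nB ⊕ Fin mB)) :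
    Module.End ℂ (finiteParticle μ) :=
  ∑ C ∈ Finset.Icc 1 (min mA nB),
    ∑ p : {p : Fin C ↪ Fin nB // StrictAnti p}, ∑ p' : Fin C ↪ Fin mA,
      contractionSign p.1 p' • normalOrdered μ (contractedKernel μ fA fB p.1 p')
end Product

end FermionFock

end

open MeasureTheory FermionFock

/-!
The proof is Wick's theorem, obtained directly on the `N`-particle components rather than from the
canonical anticommutation relations. In a component of `A B ψ` there is one antisymmetrizer between
`A` and `B`. Written as a sum over permutations, it becomes a sum over all bijections `e` from the
left legs and spectators of `B` to the right legs and spectators of `A`, where the spectators of an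
operator are the particles it does not act on
(`coe_creators_annihilators_creators`). The signed term of `e` does not change when the spectators on
either side are permuted, since `ψ` is antisymmetric and the result is antisymmetrized. Hence it only
depends on the partial matching of the left legs of `B` with the right legs of `A` that `e` induces.
These matchings are the configurations `(π, π')`, with `C = 0` admitted (`sum_eq_sum_matches`).

The bijections with a given matching form one orbit of the permutations of the spectators, of size
`kA! kB! / r!` if `r` spectators are common to both sides (`sum_swapUncontracted`). For a standard
representative of the orbit, Fubini's theorem (`contract_assoc`) identifies the term with the one of
the contracted kernel (`pairedVector_matchingEquiv`), and the sign of the bijection is the sign of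
the configuration (`sign_matchingEquiv`). The number of bijections and the normalization constants
combine to the constants of the contracted operator (`normalization`). So `A B` is the attached
product plus the term with `C = 0` (`normalOrdered_mul_eq`).

The terms with `C = 0` of `A B` and `B A` have the same kernel up to the exchange of the variables of
the factors, which yields the sign `(-1) ^ ((nA + mA) * (nB + mB))`. They cancel in the commutator or
in the anticommutator, according to the parity.
-/

noncomputable section

namespace FermionFock

/-! ### Relabelling and contraction of kernels -/

section Toolbox

theorem measurable_sumElim {X ι α β : Type*} [MeasurableSpace X] [MeasurableSpace ι]
    {f : ι → (α → X)} {g : ι → (β → X)} (hf : Measurable f) (hg : Measurable g) :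
    Measurable fun i => (Sum.elim (f i) (g i) : α ⊕ β → X) := by
  refine measurable_pi_lambda _ fun j => ?_
  rcases j with j | j
  · exact (measurable_pi_apply j).comp hf
  · exact (measurable_pi_apply j).comp hg

variable {X : Type*} [MeasurableSpace X] (μ : Measure X) [SigmaFinite μ]

theorem reindex_refl {ι : Type*} [Fintype ι] (ψ : L2 μ ι) : reindex μ (Equiv.refl ι) ψ = ψ :=
  Lp.ext (coeFn_reindex μ (Equiv.refl ι) ψ)

theorem reindex_reindex {ι κ τ : Type*} [Fintype ι] [Fintype κ] [Fintype τ] (e : ι ≃ κ)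
    (f : κ ≃ τ) (ψ : L2 μ ι) : reindex μ f (reindex μ e ψ) = reindex μ (e.trans f) ψ := by
  refine Lp.ext ?_
  filter_upwards [coeFn_reindex μ f (reindex μ e ψ), coeFn_reindex μ (e.trans f) ψ,
    (measurePreserving_reindex μ f).quasiMeasurePreserving.ae (coeFn_reindex μ e ψ)]
    with x h1 h2 h3
  rw [h1, h2, h3]
  rfl

theorem ae_sumElim {α β : Type*} [Fintype α] [Fintype β] {P : (α ⊕ β → X) → Prop}
    (h : ∀ᵐ x ∂(Measure.pi fun _ : α ⊕ β => μ), P x) :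
    ∀ᵐ x ∂(Measure.pi fun _ : α => μ), ∀ᵐ y ∂(Measure.pi fun _ : β => μ), P (Sum.elim x y) :=
  Measure.ae_ae_of_ae_prod ((measurePreserving_sumElim μ α β).quasiMeasurePreserving.ae h)

/-- Relabelling the free and the contracted variables commutes with the contraction. -/
theorem contract_reindex {α α' β β' γ γ' : Type*} [Fintype α] [Fintype α'] [Fintype β] [Fintype β']
    [Fintype γ] [Fintype γ'] (a : α ≃ α') (b : β ≃ β') (c : γ ≃ γ')
    (F : L2 μ (α ⊕ γ)) (G : L2 μ (γ ⊕ β)) :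
    contract μ (reindex μ (a.sumCongr c) F) (reindex μ (c.sumCongr b) G) =
      reindex μ (a.sumCongr b) (contract μ F G) := by
  refine Lp.ext ?_
  filter_upwards [coeFn_contract μ (reindex μ (a.sumCongr c) F) (reindex μ (c.sumCongr b) G),
    coeFn_reindex μ (a.sumCongr b) (contract μ F G),
    contractFun_congr μ (coeFn_reindex μ (a.sumCongr c) F) (coeFn_reindex μ (c.sumCongr b) G),
    (measurePreserving_reindex μ (a.sumCongr b)).quasiMeasurePreserving.ae (coeFn_contract μ F G)]
    with z h1 h2 h3 h4
  rw [h1, h2, h3, h4]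
  simp only [contractFun]
  have hc : MeasurableEmbedding (fun (x : γ' → X) (i : γ) => x (c i)) :=
    (MeasurableEquiv.piCongrLeft (fun _ : γ' => X) c).symm.measurableEmbedding
  rw [← (measurePreserving_reindex μ c).integral_comp hc]
  refine integral_congr_ae (.of_forall fun w => ?_)
  refine congrArg₂ (· * ·) (congrArg _ ?_) (congrArg _ ?_) <;> ext (i | i) <;> rfl

theorem contract_reindex_right {α β β' γ : Type*} [Fintype α] [Fintype β] [Fintype β']
    [Fintype γ] (b : β ≃ β') (F : L2 μ (α ⊕ γ)) (G : L2 μ (γ ⊕ β)) :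
    contract μ F (reindex μ ((Equiv.refl γ).sumCongr b) G) =
      reindex μ ((Equiv.refl α).sumCongr b) (contract μ F G) := by
  rw [← contract_reindex μ (Equiv.refl α) b (Equiv.refl γ), Equiv.sumCongr_refl, reindex_refl]

/-- Exchanging the two kernels; the contracted variables keep their place in the middle. -/
theorem contract_comm {α β γ : Type*} [Fintype α] [Fintype β] [Fintype γ]
    (F : L2 μ (α ⊕ γ)) (G : L2 μ (γ ⊕ β)) :
    contract μ F G = reindex μ (Equiv.sumComm β α)
      (contract μ (reindex μ (Equiv.sumComm γ β) G) (reindex μ (Equiv.sumComm α γ) F)) := by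
  refine Lp.ext ?_
  have e := measurePreserving_reindex μ (Equiv.sumComm β α)
  filter_upwards [coeFn_contract μ F G, coeFn_reindex μ (Equiv.sumComm β α)
      (contract μ (reindex μ (Equiv.sumComm γ β) G) (reindex μ (Equiv.sumComm α γ) F)),
    e.quasiMeasurePreserving.ae (coeFn_contract μ (reindex μ (Equiv.sumComm γ β) G)
      (reindex μ (Equiv.sumComm α γ) F)),
    e.quasiMeasurePreserving.ae (contractFun_congr μ (coeFn_reindex μ (Equiv.sumComm γ β) G)
      (coeFn_reindex μ (Equiv.sumComm α γ) F))] with z h1 h2 h3 h4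
  rw [h1, h2, h3, h4]
  simp only [contractFun]
  refine integral_congr_ae (.of_forall fun w => ?_)
  simp only
  rw [mul_comm]
  refine congrArg₂ (· * ·) (congrArg _ ?_) (congrArg _ ?_) <;> ext (i | i) <;> rfl


/-- The product of three square-integrable kernels, each pair of which shares a group of variables,
is integrable in the shared variables for almost all values of the other ones. -/
theorem ae_integrable_triple {a α ρ β γ δ : Type*} [Fintype a] [Fintype α] [Fintype ρ] [Fintype β]
    [Fintype γ] [Fintype δ] (F : L2 μ ((a ⊕ β) ⊕ γ)) (G : L2 μ (γ ⊕ (α ⊕ δ)))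
    (ψ : L2 μ ((β ⊕ δ) ⊕ ρ)) :
    ∀ᵐ z ∂(Measure.pi fun _ : (a ⊕ α) ⊕ ρ => μ), Integrable (fun q : (β ⊕ γ → X) × (δ → X) =>
      F (Sum.elim (Sum.elim (fun i => z (.inl (.inl i))) (fun i => q.1 (.inl i)))
          (fun i => q.1 (.inr i))) *
        (G (Sum.elim (fun i => q.1 (.inr i)) (Sum.elim (fun i => z (.inl (.inr i))) q.2)) *
          ψ (Sum.elim (Sum.elim (fun i => q.1 (.inl i)) q.2) (fun i => z (.inr i)))))
      ((Measure.pi fun _ => μ).prod (Measure.pi fun _ => μ)) := by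
  -- The contraction of `|G|` with `|ψ|` is square-integrable, hence integrable against `|F|`.
  have hF : MemLp (fun x : a ⊕ (β ⊕ γ) → X => ((‖F (fun i => x (Equiv.sumAssoc a β γ i))‖ : ℝ) : ℂ))
      2 (Measure.pi fun _ => μ) :=
    (Lp.memLp F).norm.ofReal.comp_measurePreserving
      (measurePreserving_reindex μ (Equiv.sumAssoc a β γ))
  have hG : MemLp (fun x : (γ ⊕ α) ⊕ δ → X =>
      ((‖G (fun i => x ((Equiv.sumAssoc γ α δ).symm i))‖ : ℝ) : ℂ)) 2 (Measure.pi fun _ => μ) :=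
    (Lp.memLp G).norm.ofReal.comp_measurePreserving
      (measurePreserving_reindex μ (Equiv.sumAssoc γ α δ).symm)
  let t : (β ⊕ δ) ⊕ ρ ≃ δ ⊕ (β ⊕ ρ) :=
    ((Equiv.sumComm β δ).sumCongr (Equiv.refl ρ)).trans (Equiv.sumAssoc δ β ρ)
  let s : (γ ⊕ α) ⊕ (β ⊕ ρ) ≃ (β ⊕ γ) ⊕ (α ⊕ ρ) :=
    (Equiv.sumSumSumComm γ α β ρ).trans ((Equiv.sumComm γ β).sumCongr (Equiv.refl (α ⊕ ρ)))
  have hψ : MemLp (fun x : δ ⊕ (β ⊕ ρ) → X => ((‖ψ (fun i => x (t i))‖ : ℝ) : ℂ))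
      2 (Measure.pi fun _ => μ) :=
    (Lp.memLp ψ).norm.ofReal.comp_measurePreserving (measurePreserving_reindex μ t)
  have hH := (memLp_contractFun μ hG hψ).comp_measurePreserving (measurePreserving_reindex μ s)
  have outer := (measurePreserving_reindex μ (Equiv.sumAssoc a α ρ).symm).quasiMeasurePreserving.ae
    (ae_integrable_contract μ hF hH)
  have inner := (measurePreserving_reindex μ (s.trans (Equiv.sumComm _ _))).quasiMeasurePreserving.ae
    (ae_integrable_contract μ hG hψ)
  have inner := ae_sumElim μ inner
  have hz : Measure.QuasiMeasurePreserving
      (fun (z : (a ⊕ α) ⊕ ρ → X) (i : α ⊕ ρ) => z ((Equiv.sumAssoc a α ρ).symm (.inr i)))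
      (Measure.pi fun _ => μ) (Measure.pi fun _ => μ) :=
    (Measure.quasiMeasurePreserving_snd.comp
      (measurePreserving_sumSplit μ a (α ⊕ ρ)).quasiMeasurePreserving).comp
      (measurePreserving_reindex μ (Equiv.sumAssoc a α ρ).symm).quasiMeasurePreserving
  filter_upwards [outer, hz.ae inner] with z h1 h2
  have mF : StronglyMeasurable F := Lp.stronglyMeasurable F
  have mG : StronglyMeasurable G := Lp.stronglyMeasurable G
  have mψ : StronglyMeasurable ψ := Lp.stronglyMeasurable ψ
  have m1 : Measurable fun q : (β ⊕ γ → X) × (δ → X) => fun i : β => q.1 (.inl i) := by fun_prop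
  have m2 : Measurable fun q : (β ⊕ γ → X) × (δ → X) => fun i : γ => q.1 (.inr i) := by fun_prop
  have hm := (mF.comp_measurable (measurable_sumElim (measurable_sumElim (measurable_const (a :=
    fun i => z (.inl (.inl i)))) m1) m2)).mul ((mG.comp_measurable (measurable_sumElim m2
      (measurable_sumElim (measurable_const (a := fun i => z (.inl (.inr i)))) measurable_snd))).mul
      (mψ.comp_measurable (measurable_sumElim (measurable_sumElim m1 measurable_snd)
        (measurable_const (a := fun i => z (.inr i))))))
  refine Iff.mpr (integrable_prod_iff ?_) ⟨?_, ?_⟩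
  · exact hm.aestronglyMeasurable
  · filter_upwards [h2] with v h2
    refine Integrable.const_mul ?_ _
    refine h2.norm.mono' ?_ (.of_forall fun y => le_of_eq ?_)
    · have m3 : Measurable fun y : δ → X => (Sum.elim (fun i => v (.inr i))
          (Sum.elim (fun i => z (.inl (.inr i))) y) : γ ⊕ (α ⊕ δ) → X) :=
        measurable_sumElim measurable_const (measurable_sumElim measurable_const measurable_id)
      have m4 : Measurable fun y : δ → X => (Sum.elim (Sum.elim (fun i => v (.inl i)) y)
          (fun i => z (.inr i)) : (β ⊕ δ) ⊕ ρ → X) :=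
        measurable_sumElim (measurable_sumElim measurable_const measurable_id) measurable_const
      exact ((mG.comp_measurable m3).mul (mψ.comp_measurable m4)).aestronglyMeasurable
    · simp only [norm_mul, Complex.norm_real, norm_norm]
      refine congrArg₂ (· * ·) (congrArg (fun x => ‖G x‖) ?_) (congrArg (fun x => ‖ψ x‖) ?_)
      · ext (i | i | i) <;> rfl
      · ext ((i | i) | i) <;> rfl
  · refine h1.norm.congr (.of_forall fun v => ?_)
    simp only [Function.comp_def, contractFun, norm_mul, Complex.norm_real, norm_norm,
      integral_const_mul]
    refine congrArg₂ (· * ·) (congrArg (fun x => ‖F x‖) ?_) ?_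
    · ext ((i | i) | i) <;> rfl
    · simp only [← Complex.ofReal_mul, integral_complex_ofReal, Complex.norm_real]
      rw [Real.norm_of_nonneg (integral_nonneg fun y => by positivity)]
      refine integral_congr_ae (.of_forall fun y => ?_)
      refine congrArg₂ (· * ·) (congrArg (fun x => ‖G x‖) ?_) (congrArg (fun x => ‖ψ x‖) ?_)
      · ext (i | i | i) <;> rfl
      · ext ((i | i) | i) <;> rfl

/-- Associativity of contractions: three kernels, each pair of which shares a group of variables
(`β` for `F` and `ψ`, `γ` for `F` and `G`, `δ` for `G` and `ψ`), can be contracted in either order. -/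
theorem contract_assoc {a α ρ β γ δ : Type*} [Fintype a] [Fintype α] [Fintype ρ] [Fintype β]
    [Fintype γ] [Fintype δ] (F : L2 μ ((a ⊕ β) ⊕ γ)) (G : L2 μ (γ ⊕ (α ⊕ δ)))
    (ψ : L2 μ ((β ⊕ δ) ⊕ ρ)) :
    contract μ (reindex μ (Equiv.sumSumSumComm a β α δ) (contract μ F G)) ψ =
      reindex μ (Equiv.sumAssoc a α ρ).symm (contract μ (reindex μ (Equiv.sumAssoc a β γ) F)
        (reindex μ ((Equiv.sumSumSumComm γ α β ρ).trans
            ((Equiv.sumComm γ β).sumCongr (Equiv.refl (α ⊕ ρ))))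
          (contract μ (reindex μ (Equiv.sumAssoc γ α δ).symm G)
            (reindex μ (((Equiv.sumComm β δ).sumCongr (Equiv.refl ρ)).trans
              (Equiv.sumAssoc δ β ρ)) ψ)))) := by
  -- Both sides are iterated integrals of one integrable function of all contracted variables.
  let t : (β ⊕ δ) ⊕ ρ ≃ δ ⊕ (β ⊕ ρ) :=
    ((Equiv.sumComm β δ).sumCongr (Equiv.refl ρ)).trans (Equiv.sumAssoc δ β ρ)
  let s : (γ ⊕ α) ⊕ (β ⊕ ρ) ≃ (β ⊕ γ) ⊕ (α ⊕ ρ) :=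
    (Equiv.sumSumSumComm γ α β ρ).trans ((Equiv.sumComm γ β).sumCongr (Equiv.refl (α ⊕ ρ)))
  set u := Equiv.sumSumSumComm a β α δ
  set v := (Equiv.sumAssoc a α ρ).symm
  have left := (coeFn_contract μ (reindex μ u (contract μ F G)) ψ).trans (contractFun_congr μ
    ((coeFn_reindex μ u (contract μ F G)).trans ((measurePreserving_reindex μ
      u).quasiMeasurePreserving.ae (coeFn_contract μ F G))) .rfl)
  have right1 : ⇑(reindex μ s (contract μ (reindex μ (Equiv.sumAssoc γ α δ).symm G)
      (reindex μ t ψ))) =ᵐ[Measure.pi fun _ => μ] fun x => contractFun μ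
        (fun x => G fun i => x ((Equiv.sumAssoc γ α δ).symm i)) (fun x => ψ fun i => x (t i))
          (fun i => x (s i)) :=
    (coeFn_reindex μ s _).trans ((measurePreserving_reindex μ s).quasiMeasurePreserving.ae
      ((coeFn_contract μ _ _).trans (contractFun_congr μ (coeFn_reindex μ _ G)
        (coeFn_reindex μ t ψ))))
  have right := (coeFn_reindex μ v _).trans
    ((measurePreserving_reindex μ v).quasiMeasurePreserving.ae
    ((coeFn_contract μ (reindex μ (Equiv.sumAssoc a β γ) F) (reindex μ s (contract μ
      (reindex μ (Equiv.sumAssoc γ α δ).symm G) (reindex μ t ψ)))).trans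
      (contractFun_congr μ (coeFn_reindex μ _ F) right1)))
  refine Lp.ext ?_
  filter_upwards [left, right, ae_integrable_triple μ F G ψ] with z hl hr hi
  refine hl.trans (Eq.trans ?_ hr.symm)
  have hr' := integral_prod _ hi
  let k : (β ⊕ γ) ⊕ δ ≃ (β ⊕ δ) ⊕ γ := (Equiv.sumAssoc β γ δ).trans
    (((Equiv.refl β).sumCongr (Equiv.sumComm γ δ)).trans (Equiv.sumAssoc β δ γ).symm)
  have hk := (measurePreserving_sumSplit μ (β ⊕ γ) δ).comp
    ((measurePreserving_reindex μ k).comp (measurePreserving_sumElim μ (β ⊕ δ) γ))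
  have hi' := hk.integrable_comp_of_integrable hi
  have hl' := integral_prod _ hi'
  have hlr : _ = _ := (integral_map hk.measurable.aemeasurable
    (hk.map_eq.symm ▸ hi.aestronglyMeasurable)).symm
  rw [hk.map_eq] at hlr
  refine Eq.trans ?_ (hl'.symm.trans (hlr.trans (hr'.trans ?_)))
  · simp only [contractFun, ← integral_mul_const]
    refine integral_congr_ae (.of_forall fun x => integral_congr_ae (.of_forall fun y => ?_))
    simp only [Function.comp, ← mul_assoc]
    refine congrArg₂ (· * ·) (congrArg₂ (· * ·) (congrArg F ?_) (congrArg G ?_)) (congrArg ψ ?_)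
    · ext ((i | i) | i) <;> rfl
    · ext (i | i | i) <;> rfl
    · ext ((i | i) | i) <;> rfl
  · simp only [contractFun, integral_const_mul]
    refine integral_congr_ae (.of_forall fun x => ?_)
    refine congrArg₂ (· * ·) (congrArg F ?_) (integral_congr_ae (.of_forall fun y =>
      congrArg₂ (· * ·) (congrArg G ?_) (congrArg ψ ?_)))
    · ext ((i | i) | i) <;> rfl
    · ext (i | i | i) <;> rfl
    · ext ((i | i) | i) <;> rfl

end Toolbox

/-! ### Equivalences with a prescribed matching -/

section Matching

theorem symm_trans_eq_iff {ι κ τ : Type*} (s : ι ≃ κ) (f : ι ≃ τ) (g : κ ≃ τ) :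
    s.symm.trans f = g ↔ f = s.trans g := by
  constructor <;> rintro rfl <;> ext <;> simp


/-- The bijection that keeps the contracted legs `γ`, and takes the uncontracted legs `α`, `β` of
either side to the other side. -/
def swapUncontracted (α β γ ρ : Type*) : (α ⊕ γ) ⊕ (β ⊕ ρ) ≃ (β ⊕ γ) ⊕ (α ⊕ ρ) :=
  ((Equiv.sumComm α γ).sumCongr (Equiv.refl (β ⊕ ρ))).trans ((Equiv.sumSumSumComm γ α β ρ).trans
    ((Equiv.sumComm γ β).sumCongr (Equiv.refl (α ⊕ ρ))))

/-- Permutations of the spectators on either side act transitively on the bijections that match the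
legs `γ` with each other and no leg of `α` with one of `β`. -/
theorem exists_perm_swapUncontracted {α β γ ρ : Type*} [Finite α] [Finite β] [Finite ρ]
    (e : (α ⊕ γ) ⊕ (β ⊕ ρ) ≃ (β ⊕ γ) ⊕ (α ⊕ ρ)) (h1 : ∀ c, e (.inl (.inr c)) = .inl (.inr c))
    (h2 : ∀ a, ∃ k, e (.inl (.inl a)) = .inr k) :
    ∃ (σ : Equiv.Perm (β ⊕ ρ)) (τ : Equiv.Perm (α ⊕ ρ)),
      e = ((Equiv.refl _).sumCongr σ).symm.trans
        ((swapUncontracted α β γ ρ).trans ((Equiv.refl _).sumCongr τ)) := by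
  have h3 : ∀ b, ∃ k, e (.inr k) = .inl (.inl b) := by
    intro b
    obtain ⟨(a | c) | k, hk⟩ := e.surjective (.inl (.inl b))
    · obtain ⟨k, hk'⟩ := h2 a
      simp [hk'] at hk
    · simp [h1] at hk
    · exact ⟨k, hk⟩
  choose v hv using h3
  have hvi : Function.Injective v := fun b b' hbb => by
    have := hv b
    rw [hbb, hv b'] at this
    simpa using this.symm
  obtain ⟨σ, hσ⟩ := Equiv.Perm.exists_extending_pair (Sum.inl : β → β ⊕ ρ) v Sum.inl_injective hvi
  set s : (α ⊕ γ) ⊕ (β ⊕ ρ) ≃ (α ⊕ γ) ⊕ (β ⊕ ρ) := (Equiv.refl _).sumCongr σ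
  have h4 : ∀ y : α ⊕ ρ, ∃ k, e (s ((swapUncontracted α β γ ρ).symm (.inr y))) = .inr k := by
    rintro (a | r)
    · exact h2 a
    · have : s ((swapUncontracted α β γ ρ).symm (.inr (.inr r))) = .inr (σ (.inr r)) := rfl
      rw [this]
      rcases hk : e (.inr (σ (.inr r))) with (b | c) | k
      · have := hv b
        rw [← hk, e.apply_eq_iff_eq, ← hσ] at this
        simp at this
      · rw [← h1, e.apply_eq_iff_eq] at hk
        simp at hk
      · exact ⟨k, rfl⟩
  choose t ht using h4
  have hti : Function.Injective t := fun y y' hy => by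
    have := ht y
    rw [hy, ← ht y'] at this
    simpa using this
  refine ⟨σ, Equiv.ofBijective t (Finite.injective_iff_bijective.1 hti), ?_⟩
  refine ((symm_trans_eq_iff _ _ _).2 ?_).symm
  symm
  ext x : 1
  obtain ⟨x, rfl⟩ := (swapUncontracted α β γ ρ).symm.surjective x
  rcases x with (b | c) | y
  · change e (.inr (σ (.inl b))) = .inl (.inl b)
    rw [hσ, hv]
  · exact h1 c
  · rw [Equiv.trans_apply, Equiv.trans_apply, Equiv.apply_symm_apply]
    exact ht y

open Classical in
/-- The sum over all bijections with a given matching of a function invariant under permutations of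
the spectators, by the orbit-stabilizer theorem. -/
theorem sum_swapUncontracted {V α β γ ρ : Type*} [AddCommMonoid V] [Fintype α] [Fintype β]
    [Fintype γ] [Fintype ρ] (F : ((α ⊕ γ) ⊕ (β ⊕ ρ) ≃ (β ⊕ γ) ⊕ (α ⊕ ρ)) → V)
    (hF1 : ∀ e σ, F (((Equiv.refl _).sumCongr σ).trans e) = F e)
    (hF2 : ∀ e τ, F (e.trans ((Equiv.refl _).sumCongr τ)) = F e) :
    (Fintype.card ρ).factorial • ∑ e, (if (∀ c, e (.inl (.inr c)) = .inl (.inr c)) ∧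
        ∀ a, ∃ k, e (.inl (.inl a)) = .inr k then F e else 0) =
      ((Fintype.card (β ⊕ ρ)).factorial * (Fintype.card (α ⊕ ρ)).factorial) •
        F (swapUncontracted α β γ ρ) := by
  let act : MulAction (Equiv.Perm (β ⊕ ρ) × Equiv.Perm (α ⊕ ρ))
      ((α ⊕ γ) ⊕ (β ⊕ ρ) ≃ (β ⊕ γ) ⊕ (α ⊕ ρ)) :=
    { smul := fun g e => ((Equiv.refl _).sumCongr g.1).symm.trans
        (e.trans ((Equiv.refl _).sumCongr g.2))
      one_smul := fun e => by
        ext x : 1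
        change Sum.map id id (e (Sum.map id id x)) = _
        simp
      mul_smul := fun g h e => by
        ext x : 1
        change Sum.map id (g.2 * h.2) (e (Sum.map id ⇑(g.1 * h.1)⁻¹ x)) =
          Sum.map id g.2 (Sum.map id h.2 (e (Sum.map id ⇑(h.1⁻¹) (Sum.map id ⇑(g.1⁻¹) x))))
        rw [Sum.map_map, Sum.map_map, mul_inv_rev]
        rfl }
  set e₀ := swapUncontracted α β γ ρ
  have horb : ∀ e, ((∀ c, e (.inl (.inr c)) = .inl (.inr c)) ∧
      ∀ a, ∃ k, e (.inl (.inl a)) = .inr k) ↔ e ∈ MulAction.orbit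
        (Equiv.Perm (β ⊕ ρ) × Equiv.Perm (α ⊕ ρ)) e₀ := by
    intro e
    constructor
    · rintro ⟨h1, h2⟩
      obtain ⟨σ, τ, h⟩ := exists_perm_swapUncontracted e h1 h2
      exact ⟨(σ, τ), h.symm⟩
    · rintro ⟨⟨σ, τ⟩, rfl⟩
      exact ⟨fun c => rfl, fun a => ⟨τ (.inl a), rfl⟩⟩
  have hconst : ∀ e ∈ MulAction.orbit (Equiv.Perm (β ⊕ ρ) × Equiv.Perm (α ⊕ ρ)) e₀,
      F e = F e₀ := by
    rintro _ ⟨⟨σ, τ⟩, rfl⟩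
    change F (((Equiv.refl _).sumCongr σ.symm).trans (e₀.trans ((Equiv.refl _).sumCongr τ))) = F e₀
    rw [hF1, hF2]
  have hstab : Fintype.card (MulAction.stabilizer
      (Equiv.Perm (β ⊕ ρ) × Equiv.Perm (α ⊕ ρ)) e₀) = (Fintype.card ρ).factorial := by
    rw [← Fintype.card_perm]
    refine (Fintype.card_of_bijective (f := fun w : Equiv.Perm ρ =>
      (⟨((Equiv.refl β).sumCongr w, (Equiv.refl α).sumCongr w), ?_⟩ : MulAction.stabilizer
      (Equiv.Perm (β ⊕ ρ) × Equiv.Perm (α ⊕ ρ)) e₀)) ⟨?_, ?_⟩).symm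
    · change ((Equiv.refl _).sumCongr ((Equiv.refl β).sumCongr w)).symm.trans
        (e₀.trans ((Equiv.refl _).sumCongr ((Equiv.refl α).sumCongr w))) = e₀
      rw [symm_trans_eq_iff]
      ext ((a | c) | (b | r)) <;> rfl
    · intro w w' h
      ext r
      have := congrArg (fun g => g.1.1 (Sum.inr r)) h
      simpa using this
    · rintro ⟨⟨σ, τ⟩, h⟩
      change ((Equiv.refl _).sumCongr σ).symm.trans
        (e₀.trans ((Equiv.refl _).sumCongr τ)) = e₀ at h
      rw [symm_trans_eq_iff] at h
      have hh := fun x => congrArg (fun f => f x) h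
      have h1 : ∀ a, τ (.inl a) = .inl a := fun a => Sum.inr_injective (hh (.inl (.inl a)))
      have h2 : ∀ b, σ (.inl b) = .inl b := by
        intro b
        have : Sum.inl (Sum.inl b) = e₀ (.inr (σ (.inl b))) := hh (.inr (.inl b))
        rw [← Equiv.symm_apply_eq] at this
        exact (Sum.inr_injective this).symm
      have h3 : ∀ r, ∃ r', σ (.inr r) = .inr r' := by
        intro r
        rcases hr : σ (.inr r) with b | r'
        · rw [← h2, σ.apply_eq_iff_eq] at hr
          simp at hr
        · exact ⟨r', rfl⟩
      choose w hw using h3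
      have hwi : Function.Injective w := fun r r' hr => by
        have := hw r
        rw [hr, ← hw r'] at this
        simpa using this
      have h4 : ∀ r, τ (.inr r) = .inr (w r) := by
        intro r
        have : Sum.inr (τ (.inr r)) = e₀ (.inr (σ (.inr r))) := hh (.inr (.inr r))
        rw [hw] at this
        exact Sum.inr_injective this
      refine ⟨Equiv.ofBijective w (Finite.injective_iff_bijective.1 hwi),
        Subtype.ext (Prod.ext ?_ ?_)⟩
      · ext (b | r) : 1
        · exact (h2 b).symm
        · exact (hw r).symm
      · ext (b | r) : 1
        · exact (h1 b).symm
        · exact (h4 r).symm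
  have hcard := MulAction.card_orbit_mul_card_stabilizer_eq_card_group
    (Equiv.Perm (β ⊕ ρ) × Equiv.Perm (α ⊕ ρ)) e₀
  rw [hstab, Fintype.card_prod, Fintype.card_perm, Fintype.card_perm] at hcard
  rw [← hcard, mul_comm, mul_smul]
  congr 1
  simp only [horb]
  rw [← Finset.sum_filter, Finset.sum_congr rfl (g := fun _ => F e₀)
    (fun e he => hconst e (by simpa using he)), Finset.sum_const, ← Set.toFinset_card]
  congr 2
  ext e
  simp

open Classical in
/-- `sum_swapUncontracted` with relabelled legs and spectators. -/
theorem sum_trans_swapUncontracted {V α β γ ρ ι ι' κ κ' : Type*} [AddCommMonoid V] [Fintype α]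
    [Fintype β] [Fintype γ] [Fintype ρ] [Fintype ι] [Fintype ι'] [Fintype κ] [Fintype κ']
    [DecidableEq ι] [DecidableEq ι'] [DecidableEq κ] [DecidableEq κ'] (a : α ⊕ γ ≃ ι)
    (a' : β ⊕ γ ≃ ι') (b : β ⊕ ρ ≃ κ) (b' : α ⊕ ρ ≃ κ')
    (F : (ι ⊕ κ ≃ ι' ⊕ κ') → V)
    (hF1 : ∀ e σ, F (((Equiv.refl _).sumCongr σ).trans e) = F e)
    (hF2 : ∀ e τ, F (e.trans ((Equiv.refl _).sumCongr τ)) = F e) :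
    (Fintype.card ρ).factorial • ∑ e, (if (∀ c, e (.inl (a (.inr c))) = .inl (a' (.inr c))) ∧
        ∀ i, ∃ k, e (.inl (a (.inl i))) = .inr k then F e else 0) =
      ((Fintype.card κ).factorial * (Fintype.card κ').factorial) •
        F ((a.sumCongr b).symm.trans ((swapUncontracted α β γ ρ).trans (a'.sumCongr b'))) := by
  have key := sum_swapUncontracted
    (fun e => F ((a.sumCongr b).symm.trans (e.trans (a'.sumCongr b'))))
    (fun e σ => by
      refine Eq.trans (congrArg F ?_) (hF1 _ (b.symm.trans (σ.trans b)))
      ext (i | k) : 1 <;> simp)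
    (fun e τ => by
      refine Eq.trans (congrArg F ?_) (hF2 _ (b'.symm.trans (τ.trans b')))
      ext x : 1
      simp only [Equiv.trans_apply]
      rcases e ((a.sumCongr b).symm x) with i | k <;> simp)
  rw [Fintype.card_congr b, Fintype.card_congr b'] at key
  refine Eq.trans ?_ key
  congr 1
  rw [← (Equiv.equivCongr (a.sumCongr b) (a'.sumCongr b')).sum_comp]
  refine Finset.sum_congr rfl fun e _ => ?_
  refine if_congr (and_congr (forall_congr' fun c => ?_) (forall_congr' fun i => ?_)) rfl rfl
  · have : (Equiv.equivCongr (a.sumCongr b) (a'.sumCongr b') e) (.inl (a (.inr c))) =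
        Sum.map a' b' (e (.inl (.inr c))) := by simp
    rw [this]
    rcases e (.inl (.inr c)) with j | k <;> simp
  · have : (Equiv.equivCongr (a.sumCongr b) (a'.sumCongr b') e) (.inl (a (.inl i))) =
        Sum.map a' b' (e (.inl (.inl i))) := by simp
    rw [this]
    rcases e (.inl (.inl i)) with j | k <;> simp

/-- `e` matches the leg `p c` with the leg `p' c`, and no other legs with each other. -/
def Matches {C n m : ℕ} {κ κ' : Type*} (e : Fin n ⊕ κ ≃ Fin m ⊕ κ') (p : Fin C ↪ Fin n)
    (p' : Fin C ↪ Fin m) : Prop :=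
  (∀ c, e (.inl (p c)) = .inl (p' c)) ∧ ∀ x, (∀ c, p c ≠ x) → ∃ k, e (.inl x) = .inr k

theorem matches_iff {C n m : ℕ} {κ κ' : Type*} (e : Fin n ⊕ κ ≃ Fin m ⊕ κ') (p : Fin C ↪ Fin n)
    (p' : Fin C ↪ Fin m) : Matches e p p' ↔ (∀ c, e (.inl (p c)) = .inl (p' c)) ∧
      ∀ i, ∃ k, e (.inl (legSplit p (.inl i))) = .inr k := by
  refine and_congr_right fun _ => ⟨fun h i => h _ fun c hc => ?_, fun h x hx => ?_⟩
  · have : legSplit p (.inr c) = legSplit p (.inl i) := hc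
    simp at this
  · obtain ⟨i | c, rfl⟩ := (legSplit p).surjective x
    · exact h i
    · exact absurd rfl (hx c)

/-- The bijection that matches `p c` with `p' c`, and takes the other legs to the first spectators on
the other side, in reversed order. -/
def matchingEquiv {C n m r k k' : ℕ} (p : Fin C ↪ Fin n) (p' : Fin C ↪ Fin m)
    (h : m - C + r = k) (h' : n - C + r = k') : Fin n ⊕ Fin k ≃ Fin m ⊕ Fin k' :=
  ((legSplit p).sumCongr (revFirst h)).symm.trans ((swapUncontracted _ _ _ _).trans
    ((legSplit p').sumCongr (revFirst h')))

open Classical in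
theorem sum_matches {V : Type*} [AddCommMonoid V] {C n m r k k' : ℕ} (p : Fin C ↪ Fin n)
    (p' : Fin C ↪ Fin m) (h : m - C + r = k) (h' : n - C + r = k')
    (F : (Fin n ⊕ Fin k ≃ Fin m ⊕ Fin k') → V)
    (hF1 : ∀ e σ, F (((Equiv.refl _).sumCongr σ).trans e) = F e)
    (hF2 : ∀ e τ, F (e.trans ((Equiv.refl _).sumCongr τ)) = F e) :
    r.factorial • ∑ e, (if Matches e p p' then F e else 0) =
      (k.factorial * k'.factorial) • F (matchingEquiv p p' h h') := by
  have key := sum_trans_swapUncontracted (legSplit p) (legSplit p') (revFirst h) (revFirst h') F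
    hF1 hF2
  rw [Fintype.card_fin, Fintype.card_fin, Fintype.card_fin] at key
  refine (congrArg _ (Finset.sum_congr rfl fun e _ => ?_)).trans key
  by_cases hm : Matches e p p'
  · rw [if_pos hm]
    exact (if_pos ((matches_iff e p p').1 hm)).symm
  · rw [if_neg hm]
    exact (if_neg fun h => hm ((matches_iff e p p').2 h)).symm

/-- The `n - C` unmatched legs are taken injectively to spectators, so there must be enough of
them. -/
theorem le_of_matches {C n m k k' : ℕ} {e : Fin n ⊕ Fin k ≃ Fin m ⊕ Fin k'} {p : Fin C ↪ Fin n}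
    {p' : Fin C ↪ Fin m} (h : Matches e p p') : n - C ≤ k' := by
  choose t ht using ((matches_iff e p p').1 h).2
  have ht' : Function.Injective t := fun i j hij => by
    have := ht i
    rw [hij, ← ht j] at this
    simpa using this
  simpa using Fintype.card_le_of_injective t ht'

open Classical in
theorem map_eq_of_matches {C n m : ℕ} {κ κ' : Type*} {e : Fin n ⊕ κ ≃ Fin m ⊕ κ'}
    {p : Fin C ↪ Fin n} {p' : Fin C ↪ Fin m} (h : Matches e p p') :
    Finset.univ.map p = Finset.univ.filter fun x => (e (.inl x)).isLeft := by
  ext x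
  simp only [Finset.mem_map, Finset.mem_univ, true_and, Finset.mem_filter]
  constructor
  · rintro ⟨c, rfl⟩
    rw [h.1]
    rfl
  · intro hx
    by_contra hc
    obtain ⟨k, hk⟩ := h.2 x (by simpa using hc)
    simp [hk] at hx

theorem eq_of_strictAnti {C n : ℕ} {p q : Fin C ↪ Fin n} (hp : StrictAnti p) (hq : StrictAnti q)
    (h : Finset.univ.map p = Finset.univ.map q) : p = q := by
  have hcard : (Finset.univ.map p).card = C := by simp
  have h1 := Finset.orderEmbOfFin_unique hcard (f := p ∘ Fin.rev) (by simp)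
    (hp.comp Fin.rev_strictAnti)
  have h2 := Finset.orderEmbOfFin_unique hcard (f := q ∘ Fin.rev) (by simp [h])
    (hq.comp Fin.rev_strictAnti)
  ext c : 1
  simpa using congrFun (h1.trans h2.symm) c.rev

/-- The matching of a bijection, with the matched legs listed in decreasing order. -/
theorem exists_matches {n m : ℕ} {κ κ' : Type*} (e : Fin n ⊕ κ ≃ Fin m ⊕ κ') :
    ∃ (C : ℕ) (p : Fin C ↪ Fin n) (p' : Fin C ↪ Fin m), StrictAnti p ∧ Matches e p p' := by
  classical
  set s := Finset.univ.filter fun x => (e (.inl x)).isLeft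
  let p : Fin s.card ↪ Fin n := Fin.revPerm.toEmbedding.trans (s.orderEmbOfFin rfl).toEmbedding
  have hp : Finset.univ.map p = s := by
    ext x
    have := Finset.range_orderEmbOfFin s rfl
    rw [Set.ext_iff] at this
    simp only [Finset.mem_map, Finset.mem_univ, true_and]
    rw [← Finset.mem_coe, ← this, ← Fin.revPerm.surjective.range_comp]
    rfl
  have h : ∀ c, ∃ y, e (.inl (p c)) = .inl y := by
    intro c
    have := Finset.mem_map_of_mem p (Finset.mem_univ c)
    rw [hp, Finset.mem_filter] at this
    exact Sum.isLeft_iff.1 this.2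
  choose p' hp' using h
  refine ⟨s.card, p, ⟨p', fun c d hcd => ?_⟩, ?_, hp', fun x hx => ?_⟩
  · have := hp' c
    rw [hcd, ← hp' d] at this
    simpa using this
  · exact (s.orderEmbOfFin rfl).strictMono.comp_strictAnti Fin.rev_strictAnti
  · rcases hk : e (.inl x) with y | k
    · have : x ∈ Finset.univ.map p := by rw [hp]; simp [s, hk]
      obtain ⟨c, -, hc⟩ := Finset.mem_map.1 this
      exact absurd hc (hx c)
    · exact ⟨k, rfl⟩

open Classical in
/-- Each bijection has exactly one matching. -/
theorem sum_eq_sum_matches {V : Type*} [AddCommMonoid V] {n m : ℕ} {κ κ' : Type*} [Fintype κ]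
    [Fintype κ'] [DecidableEq κ] [DecidableEq κ'] (F : (Fin n ⊕ κ ≃ Fin m ⊕ κ') → V) :
    ∑ e, F e = ∑ C ∈ Finset.range (min m n + 1),
      ∑ p : {p : Fin C ↪ Fin n // StrictAnti p}, ∑ p' : Fin C ↪ Fin m,
        ∑ e, if Matches e p.1 p' then F e else 0 := by
  refine Eq.trans ?_ (Finset.sum_congr rfl fun C _ =>
    Finset.sum_comm.trans (Finset.sum_congr rfl fun p _ => Finset.sum_comm))
  rw [Finset.sum_comm]
  refine Finset.sum_congr rfl fun e _ => ?_
  obtain ⟨C, p, p', hp, h⟩ := exists_matches e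
  have hn : C ≤ n := by simpa using Fintype.card_le_of_embedding p
  have hm : C ≤ m := by simpa using Fintype.card_le_of_embedding p'
  rw [Finset.sum_eq_single C, Finset.sum_eq_single ⟨p, hp⟩, Finset.sum_eq_single p', if_pos h]
  · rintro q' - hq
    refine if_neg fun h' => hq ?_
    ext c : 1
    have := h.1 c
    rw [h'.1 c] at this
    simpa using this
  · simp
  · rintro ⟨q, hq⟩ - hqp
    refine Finset.sum_eq_zero fun q' _ => if_neg fun h' => hqp (Subtype.ext ?_)
    exact eq_of_strictAnti hq hp ((map_eq_of_matches h').trans (map_eq_of_matches h).symm)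
  · simp
  · intro D _ hD
    refine Finset.sum_eq_zero fun q _ => Finset.sum_eq_zero fun q' _ => if_neg fun h' => hD ?_
    simpa using congrArg Finset.card ((map_eq_of_matches h').trans (map_eq_of_matches h).symm)
  · intro h'
    exact absurd (Finset.mem_range.2 (by omega)) h'

end Matching

/-! ### Signs of block permutations -/

section Sign

theorem sign_conj {ι κ : Type*} [Fintype ι] [Fintype κ] [DecidableEq ι] [DecidableEq κ]
    (f : ι ≃ κ) (τ : Equiv.Perm ι) :
    Equiv.Perm.sign (f.symm.trans (Equiv.trans τ f)) = Equiv.Perm.sign τ :=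
  Equiv.Perm.sign_symm_trans_trans τ f

theorem revFirst_inl {n k N : ℕ} (h : n + k = N) (i : Fin n) :
    (revFirst h (.inl i) : ℕ) = n - 1 - i := by
  simp [revFirst, Fin.val_rev]
  omega

theorem revFirst_inr {n k N : ℕ} (h : n + k = N) (i : Fin k) :
    (revFirst h (.inr i) : ℕ) = n + i := by
  simp [revFirst]

/-- The permutation of `a + b` positions that exchanges the first block of length `a` with the
second block of length `b`. -/
def blockSwap (a b : ℕ) : Equiv.Perm (Fin (a + b)) :=
  finAddFlip.trans (finCongr (Nat.add_comm b a))

theorem blockSwap_castAdd {a b : ℕ} (i : Fin a) :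
    (blockSwap a b (Fin.castAdd b i) : ℕ) = b + i := by
  simp [blockSwap, add_comm]

theorem blockSwap_natAdd {a b : ℕ} (i : Fin b) :
    (blockSwap a b (Fin.natAdd a i) : ℕ) = i := by
  simp [blockSwap]

/-- The exchange of the blocks is the `b`-th power of the rotation of all positions. -/
theorem sign_blockSwap (a b : ℕ) : Equiv.Perm.sign (blockSwap a b) = (-1) ^ (a * b) := by
  have hpow : blockSwap a b = finRotate (a + b) ^ b := by
    have h : ∀ k (i : Fin (a + b)), ((finRotate (a + b) ^ k) i : ℕ) = (i + k) % (a + b) := by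
      intro k
      induction k with
      | zero => intro i; simp [Nat.mod_eq_of_lt i.2]
      | succ k ih =>
        intro i
        obtain ⟨N, hN⟩ : ∃ N, a + b = N + 1 := ⟨a + b - 1, by have := i.2; omega⟩
        rw [pow_succ', Equiv.Perm.mul_apply]
        generalize hx : (finRotate (a + b) ^ k) i = x
        have := ih i
        rw [hx] at this
        clear ih hx
        revert i x
        rw [hN]
        intro i x this
        rw [finRotate_apply, Fin.val_add, this, Fin.val_one']
        rw [← Nat.add_mod, add_assoc]
    ext i
    rw [h]
    refine Fin.addCases (fun i => ?_) (fun i => ?_) i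
    · rw [blockSwap_castAdd, Fin.val_castAdd, Nat.mod_eq_of_lt (by omega), add_comm]
    · rw [blockSwap_natAdd, Fin.val_natAdd, show a + i + b = i + (a + b) by omega,
        Nat.add_mod_right, Nat.mod_eq_of_lt (by omega)]
  rw [hpow, map_pow, sign_finRotate, ← pow_mul]
  rcases b with _ | b
  · simp
  · rw [show a + (b + 1) - 1 = a + b by omega, add_mul, pow_add, mul_comm b,
      mul_comm (b + 1) b, (Nat.even_mul_succ_self b).neg_one_pow, mul_one]

theorem legSplit_maximalCrossing_inl {C n : ℕ} (h : C ≤ n) (i : Fin (n - C)) :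
    (legSplit (maximalCrossing h) (.inl i) : ℕ) = i := by
  have := Finset.orderEmbOfFin_unique (s := uncontracted (maximalCrossing h))
    (card_uncontracted _ (maximalCrossing h).injective) (f := Fin.castLE (Nat.sub_le n C))
    (fun i => by
      simp only [uncontracted, maximalCrossing, Finset.mem_compl, Finset.mem_image, not_exists,
        Finset.mem_univ, true_and]
      intro c hc
      have := congrArg Fin.val hc
      simp [Fin.val_rev] at this
      omega) (Fin.strictMono_castLE _)
  exact (congrArg Fin.val (congrFun this i)).symm

theorem legSplit_maximalCrossing_inr {C n : ℕ} (h : C ≤ n) (c : Fin C) :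
    (legSplit (maximalCrossing h) (.inr c) : ℕ) = n - 1 - c := by
  simp [legSplit, maximalCrossing, Fin.val_rev]
  omega

/-- The maximally crossed matching is the exchange of two blocks of uncontracted legs. -/
theorem sign_matchingEquiv_maximalCrossing {C n m r k k' M : ℕ} (hn : C ≤ n) (hm : C ≤ m)
    (h : m - C + r = k) (h' : n - C + r = k') (hM : n + k = M) (hM' : m + k' = M) :
    Equiv.Perm.sign ((revFirst hM).symm.trans ((matchingEquiv (maximalCrossing hn)
      (maximalCrossing hm) h h').trans (revFirst hM'))) = (-1) ^ ((m - C) * (n - C)) := by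
  let f : Fin C ⊕ (Fin ((n - C) + (m - C)) ⊕ Fin r) ≃ Fin M :=
    (((Equiv.refl _).sumCongr finSumFinEquiv).trans finSumFinEquiv).trans (finCongr (by omega))
  have key : (revFirst hM).symm.trans ((matchingEquiv (maximalCrossing hn)
      (maximalCrossing hm) h h').trans (revFirst hM')) = f.symm.trans
      ((Equiv.Perm.sumCongr 1 (Equiv.Perm.sumCongr (blockSwap (n - C) (m - C)) 1)).trans f) := by
    rw [symm_trans_eq_iff, matchingEquiv, Equiv.trans_assoc, symm_trans_eq_iff]
    ext x
    have hf1 : ∀ c, (f (.inl c) : ℕ) = c := fun c => by simp [f]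
    have hf2 : ∀ i, (f (.inr (.inl i)) : ℕ) = C + i := fun c => by simp [f]
    have hf3 : ∀ j, (f (.inr (.inr j)) : ℕ) = C + ((n - C) + (m - C) + j) := fun j => by simp [f]
    rcases x with (i | c) | (j | l)
    · have : f.symm (revFirst hM (.inl (legSplit (maximalCrossing hn) (.inl i)))) =
          .inr (.inl (Fin.castAdd _ i.rev)) := by
        rw [Equiv.symm_apply_eq, Fin.ext_iff, hf2, revFirst_inl, legSplit_maximalCrossing_inl,
          Fin.val_castAdd, Fin.val_rev]
        omega
      change (revFirst hM' (.inr (revFirst h' (.inl i))) : ℕ) = (f (Sum.map _ _ (f.symm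
        (revFirst hM (.inl (legSplit (maximalCrossing hn) (.inl i)))))) : ℕ)
      rw [this, Sum.map_inr]
      change _ = (f (Sum.inr (.inl (blockSwap _ _ _))) : ℕ)
      rw [hf2, blockSwap_castAdd, revFirst_inr, revFirst_inl, Fin.val_rev]
      omega
    · have : f.symm (revFirst hM (.inl (legSplit (maximalCrossing hn) (.inr c)))) = .inl c := by
        rw [Equiv.symm_apply_eq, Fin.ext_iff, hf1, revFirst_inl, legSplit_maximalCrossing_inr]
        omega
      change (revFirst hM' (.inl (legSplit (maximalCrossing hm) (.inr c))) : ℕ) = (f (Sum.map _ _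
        (f.symm (revFirst hM (.inl (legSplit (maximalCrossing hn) (.inr c)))))) : ℕ)
      rw [this, Sum.map_inl]
      change _ = (f (Sum.inl c) : ℕ)
      rw [hf1, revFirst_inl, legSplit_maximalCrossing_inr]
      omega
    · have : f.symm (revFirst hM (.inr (revFirst h (.inl j)))) =
          .inr (.inl (Fin.natAdd _ j.rev)) := by
        rw [Equiv.symm_apply_eq, Fin.ext_iff, hf2, revFirst_inr, revFirst_inl,
          Fin.val_natAdd, Fin.val_rev]
        omega
      change (revFirst hM' (.inl (legSplit (maximalCrossing hm) (.inl j))) : ℕ) = (f (Sum.map _ _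
        (f.symm (revFirst hM (.inr (revFirst h (.inl j)))))) : ℕ)
      rw [this, Sum.map_inr]
      change _ = (f (Sum.inr (.inl (blockSwap _ _ _))) : ℕ)
      rw [hf2, blockSwap_natAdd, revFirst_inl, legSplit_maximalCrossing_inl, Fin.val_rev]
      omega
    · have : f.symm (revFirst hM (.inr (revFirst h (.inr l)))) = .inr (.inr l) := by
        rw [Equiv.symm_apply_eq, Fin.ext_iff, hf3, revFirst_inr, revFirst_inr]
        omega
      change (revFirst hM' (.inr (revFirst h' (.inr l))) : ℕ) = (f (Sum.map _ _
        (f.symm (revFirst hM (.inr (revFirst h (.inr l)))))) : ℕ)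
      rw [this, Sum.map_inr]
      change _ = (f (Sum.inr (.inr l)) : ℕ)
      rw [hf3, revFirst_inr, revFirst_inr]
      omega
  rw [key, sign_conj, Equiv.Perm.sign_sumCongr, Equiv.Perm.sign_sumCongr,
    sign_blockSwap]
  simp [mul_comm]

/-- Any matching is taken to the maximally crossed one by the crossing permutations of both sides,
so the sign of a configuration is the one of the underlying bijection. -/
theorem sign_matchingEquiv {C n m r k k' M : ℕ} (p : Fin C ↪ Fin n) (p' : Fin C ↪ Fin m)
    (h : m - C + r = k) (h' : n - C + r = k') (hM : n + k = M) (hM' : m + k' = M) :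
    (Equiv.Perm.sign ((revFirst hM).symm.trans ((matchingEquiv p p' h h').trans
      (revFirst hM'))) : ℤ) = contractionSign p p' := by
  have hn : C ≤ n := by simpa using Fintype.card_le_of_embedding p
  have hm : C ≤ m := by simpa using Fintype.card_le_of_embedding p'
  have key : (revFirst hM).symm.trans ((matchingEquiv p p' h h').trans (revFirst hM')) =
      ((revFirst hM).symm.trans ((Equiv.Perm.sumCongr (crossingPerm p) 1).trans
        (revFirst hM))).trans
      (((revFirst hM).symm.trans ((matchingEquiv (maximalCrossing hn)
        (maximalCrossing hm) h h').trans (revFirst hM'))).trans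
      ((revFirst hM').symm.trans ((Equiv.Perm.sumCongr (crossingPerm p').symm 1).trans
        (revFirst hM')))) := by
    ext x
    obtain ⟨x, rfl⟩ := (revFirst hM).surjective x
    simp only [Equiv.trans_apply, Equiv.symm_apply_apply]
    refine congrArg (fun y => (revFirst hM' y : ℕ)) ?_
    rcases x with i | j
    · obtain ⟨i, rfl⟩ := (legSplit p).surjective i
      rcases i with i | i <;> simp [matchingEquiv, crossingPerm, swapUncontracted]
    · obtain ⟨j, rfl⟩ := (revFirst h).surjective j
      rcases j with j | j <;> simp [matchingEquiv, crossingPerm, swapUncontracted]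
  rw [key]
  rw [Equiv.Perm.sign_trans, Equiv.Perm.sign_trans, sign_matchingEquiv_maximalCrossing,
    sign_conj, sign_conj,
    Equiv.Perm.sign_sumCongr, Equiv.Perm.sign_sumCongr, Equiv.Perm.sign_symm, contractionSign]
  push_cast
  simp
  ring

end Sign

/-! ### Wick's theorem on a sector -/

theorem sqrt_descFactorial {n k N : ℕ} (h : n + k = N) :
    √(N.descFactorial n : ℝ) = √(N.factorial : ℝ) / √(k.factorial : ℝ) := by
  rw [← Real.sqrt_div (by positivity)]
  congr 1
  have := Nat.factorial_mul_descFactorial (show n ≤ N by omega)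
  rw [show N - n = k by omega] at this
  rw [← this]
  push_cast
  field_simp

/-- The normalization constants of both factors, multiplied with the number `kB! kA! / r!` of
bijections with a given matching, give those of the contracted operator. -/
theorem normalization {nA kA mA nB kB mB n m r N M N' : ℕ} (hN : nA + kA = N) (hM' : mA + kA = M)
    (hM : nB + kB = M) (hN' : mB + kB = N') (h1 : n + r = N) (h2 : m + r = N') :
    √(N.descFactorial nA) * √(M.descFactorial mA) * √(M.descFactorial nB) *
      √(N'.descFactorial mB) / M.factorial * (kB.factorial * kA.factorial) =
    √(N.descFactorial n) * √(N'.descFactorial m) * (r.factorial : ℝ) := by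
  rw [sqrt_descFactorial hN, sqrt_descFactorial hM', sqrt_descFactorial hM, sqrt_descFactorial hN',
    sqrt_descFactorial h1, sqrt_descFactorial h2]
  field_simp
  simp only [Real.sq_sqrt, Nat.cast_nonneg]
  ring

section Wick
variable {X : Type*} [MeasurableSpace X] (μ : Measure X) [SigmaFinite μ]

theorem antisymmetrizer_apply (N : ℕ) (φ : L2 μ (Fin N)) :
    antisymmetrizer μ N φ = ((N.factorial : ℂ)⁻¹) •
      ∑ τ : Equiv.Perm (Fin N), ((Equiv.Perm.sign τ : ℤ) : ℂ) • reindex μ τ φ := by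
  simp [antisymmetrizer]

theorem sign_mul_self_complex {ι : Type*} [Fintype ι] [DecidableEq ι] (τ : Equiv.Perm ι) :
    ((Equiv.Perm.sign τ : ℤ) : ℂ) * ((Equiv.Perm.sign τ : ℤ) : ℂ) = 1 := by
  rw [← Int.cast_mul, ← Units.val_mul, Int.units_mul_self]
  simp

theorem antisymmetrizer_reindex {N : ℕ} (τ : Equiv.Perm (Fin N)) (φ : L2 μ (Fin N)) :
    antisymmetrizer μ N (reindex μ τ φ) =
      ((Equiv.Perm.sign τ : ℤ) : ℂ) • antisymmetrizer μ N φ := by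
  simp only [antisymmetrizer_apply, reindex_reindex]
  rw [smul_comm]
  congr 1
  rw [Finset.smul_sum]
  refine Fintype.sum_equiv (Equiv.mulRight τ) _ _ fun σ => ?_
  rw [smul_smul]
  refine congrArg₂ (· • ·) ?_ rfl
  simp only [Equiv.coe_mulRight, map_mul, Units.val_mul, Int.cast_mul]
  rw [mul_comm, mul_assoc, sign_mul_self_complex, mul_one]

theorem reindex_antisymmetrizer {N : ℕ} (τ : Equiv.Perm (Fin N)) (φ : L2 μ (Fin N)) :
    reindex μ τ (antisymmetrizer μ N φ) =
      ((Equiv.Perm.sign τ : ℤ) : ℂ) • antisymmetrizer μ N φ := by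
  simp only [antisymmetrizer_apply, map_smul, map_sum, reindex_reindex]
  rw [smul_comm]
  congr 1
  rw [Finset.smul_sum]
  refine Fintype.sum_equiv (Equiv.mulLeft τ) _ _ fun σ => ?_
  rw [smul_smul]
  refine congrArg₂ (· • ·) ?_ rfl
  simp only [Equiv.coe_mulLeft, map_mul, Units.val_mul, Int.cast_mul]
  rw [← mul_assoc, sign_mul_self_complex, one_mul]

theorem reindex_fermionSector {N : ℕ} (τ : Equiv.Perm (Fin N)) (ψ : fermionSector μ N) :
    reindex μ τ (ψ : L2 μ (Fin N)) = ((Equiv.Perm.sign τ : ℤ) : ℂ) • (ψ : L2 μ (Fin N)) := by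
  obtain ⟨_, φ, rfl⟩ := ψ
  exact reindex_antisymmetrizer μ τ φ

theorem coe_creators {n k N : ℕ} (h : n + k = N) (φ : L2 μ (Fin n ⊕ Fin k)) :
    (creators μ h φ : L2 μ (Fin N)) = ((√(N.descFactorial n) : ℝ) : ℂ) •
      antisymmetrizer μ N (reindex μ (revFirst h) φ) := rfl

theorem annihilators_apply {m k N : ℕ} (h : m + k = N) (ψ : fermionSector μ N) :
    annihilators μ h ψ = ((√(N.descFactorial m) : ℝ) : ℂ) •
      reindex μ (revFirst h).symm (ψ : L2 μ (Fin N)) := rfl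

/-- Permuting the spectators multiplies the antisymmetrized vector by the sign. -/
theorem antisymmetrizer_revFirst_perm {n k N : ℕ} (h : n + k = N) (τ : Equiv.Perm (Fin k))
    (φ : L2 μ (Fin n ⊕ Fin k)) :
    antisymmetrizer μ N (reindex μ (revFirst h) (reindex μ ((Equiv.refl _).sumCongr τ) φ)) =
      ((Equiv.Perm.sign τ : ℤ) : ℂ) • antisymmetrizer μ N (reindex μ (revFirst h) φ) := by
  have : Equiv.Perm.sign ((revFirst h).symm.trans
      (Equiv.trans (Equiv.Perm.sumCongr 1 τ) (revFirst h))) = Equiv.Perm.sign τ := by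
    rw [sign_conj, Equiv.Perm.sign_sumCongr, Equiv.Perm.sign_one, one_mul]
  rw [← this, ← antisymmetrizer_reindex, reindex_reindex, reindex_reindex]
  refine congrArg (fun e => antisymmetrizer μ N (reindex μ e φ)) ?_
  rw [← Equiv.trans_assoc, Equiv.self_trans_symm, Equiv.refl_trans]
  rfl

/-- A single term of `A B ψ`, without sign and normalization. The kernel `fB` is applied to `ψ`, the
left legs of `B` and its spectators are identified by `e` with the right legs of `A` and its
spectators, then `fA` is applied and the result is antisymmetrized. -/
def pairedVector {nA mA nB mB kA kB N N' : ℕ} (hN : nA + kA = N) (hN' : mB + kB = N')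
    (fA : L2 μ (Fin nA ⊕ Fin mA)) (fB : L2 μ (Fin nB ⊕ Fin mB)) (ψ : fermionSector μ N')
    (e : Fin nB ⊕ Fin kB ≃ Fin mA ⊕ Fin kA) : L2 μ (Fin N) :=
  antisymmetrizer μ N (reindex μ (revFirst hN) (contract μ fA (reindex μ e (contract μ fB
    (reindex μ (revFirst hN').symm (ψ : L2 μ (Fin N')))))))

variable {nA mA nB mB kA kB N N' M : ℕ} (hN : nA + kA = N) (hN' : mB + kB = N')
  (hM : nB + kB = M) (hM' : mA + kA = M)
  (fA : L2 μ (Fin nA ⊕ Fin mA)) (fB : L2 μ (Fin nB ⊕ Fin mB)) (ψ : fermionSector μ N')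

/-- Permuting the spectators of `A` gives a sign, as the outcome is antisymmetrized. -/
theorem pairedVector_trans (e : Fin nB ⊕ Fin kB ≃ Fin mA ⊕ Fin kA) (τ : Equiv.Perm (Fin kA)) :
    pairedVector μ hN hN' fA fB ψ (e.trans ((Equiv.refl _).sumCongr τ)) =
      ((Equiv.Perm.sign τ : ℤ) : ℂ) • pairedVector μ hN hN' fA fB ψ e := by
  rw [pairedVector, ← reindex_reindex, contract_reindex_right, antisymmetrizer_revFirst_perm]
  rfl

/-- Permuting the spectators of `B` gives a sign, as `ψ` is antisymmetric. -/
theorem pairedVector_perm_trans (e : Fin nB ⊕ Fin kB ≃ Fin mA ⊕ Fin kA)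
    (σ : Equiv.Perm (Fin kB)) :
    pairedVector μ hN hN' fA fB ψ (((Equiv.refl _).sumCongr σ).trans e) =
      ((Equiv.Perm.sign σ : ℤ) : ℂ) • pairedVector μ hN hN' fA fB ψ e := by
  have hs : Equiv.Perm.sign ((revFirst hN').symm.trans
      (Equiv.trans (Equiv.Perm.sumCongr 1 σ) (revFirst hN'))) = Equiv.Perm.sign σ := by
    rw [sign_conj, Equiv.Perm.sign_sumCongr, Equiv.Perm.sign_one, one_mul]
  have key : reindex μ ((Equiv.refl (Fin mB)).sumCongr σ)
      (reindex μ (revFirst hN').symm (ψ : L2 μ (Fin N'))) = ((Equiv.Perm.sign σ : ℤ) : ℂ) •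
      reindex μ (revFirst hN').symm (ψ : L2 μ (Fin N')) := by
    rw [← hs, ← map_smul, ← reindex_fermionSector, reindex_reindex, reindex_reindex]
    refine congrArg (fun e => reindex μ e (ψ : L2 μ (Fin N'))) ?_
    rw [Equiv.trans_assoc, Equiv.trans_assoc, Equiv.self_trans_symm, Equiv.trans_refl]
    rfl
  rw [pairedVector, ← reindex_reindex, ← contract_reindex_right, key]
  simp only [map_smul, pairedVector]

/-- The sign of a bijection of legs, with respect to the reversed orders in which the legs are
created and annihilated. -/
def pairingSign (e : Fin nB ⊕ Fin kB ≃ Fin mA ⊕ Fin kA) : ℤ :=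
  Equiv.Perm.sign ((revFirst hM).symm.trans (e.trans (revFirst hM')))

theorem pairingSign_trans (e : Fin nB ⊕ Fin kB ≃ Fin mA ⊕ Fin kA) (τ : Equiv.Perm (Fin kA)) :
    pairingSign hM hM' (e.trans ((Equiv.refl _).sumCongr τ)) =
      Equiv.Perm.sign τ * pairingSign hM hM' e := by
  have hs : Equiv.Perm.sign ((revFirst hM').symm.trans
      (Equiv.trans (Equiv.Perm.sumCongr 1 τ) (revFirst hM'))) = Equiv.Perm.sign τ := by
    rw [sign_conj, Equiv.Perm.sign_sumCongr, Equiv.Perm.sign_one, one_mul]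
  rw [pairingSign, pairingSign, ← hs, ← Units.val_mul, ← Equiv.Perm.sign_trans]
  congr 2
  ext x
  simp

theorem pairingSign_perm_trans (e : Fin nB ⊕ Fin kB ≃ Fin mA ⊕ Fin kA) (σ : Equiv.Perm (Fin kB)) :
    pairingSign hM hM' (((Equiv.refl _).sumCongr σ).trans e) =
      Equiv.Perm.sign σ * pairingSign hM hM' e := by
  have hs : Equiv.Perm.sign ((revFirst hM).symm.trans
      (Equiv.trans (Equiv.Perm.sumCongr 1 σ) (revFirst hM))) = Equiv.Perm.sign σ := by
    rw [sign_conj, Equiv.Perm.sign_sumCongr, Equiv.Perm.sign_one, one_mul]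
  rw [pairingSign, pairingSign, ← hs, mul_comm, ← Units.val_mul, ← Equiv.Perm.sign_trans]
  congr 2
  ext x
  simp

/-- The product of two normal ordered operators, expanded according to the antisymmetrizer between
them. -/
theorem coe_creators_annihilators_creators :
    (creators μ hN (contract μ fA (annihilators μ hM' (creators μ hM (contract μ fB
      (annihilators μ hN' ψ))))) : L2 μ (Fin N)) =
    (((√(N.descFactorial nA) * √(M.descFactorial mA) * √(M.descFactorial nB) *
      √(N'.descFactorial mB) / M.factorial : ℝ)) : ℂ) •
      ∑ e, (pairingSign hM hM' e : ℂ) • pairedVector μ hN hN' fA fB ψ e := by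
  rw [coe_creators, annihilators_apply, coe_creators, annihilators_apply, antisymmetrizer_apply μ M]
  let E : (Fin nB ⊕ Fin kB ≃ Fin mA ⊕ Fin kA) ≃ Equiv.Perm (Fin M) :=
    Equiv.equivCongr (revFirst hM) (revFirst hM')
  rw [← E.sum_comp]
  simp only [map_smul, map_sum, reindex_reindex, smul_smul, Finset.smul_sum]
  refine Finset.sum_congr rfl fun e _ => ?_
  have h1 : ((revFirst hM).trans (E e)).trans (revFirst hM').symm = e := by
    ext x : 1
    simp [E]
  have h2 : ((Equiv.Perm.sign (E e) : ℤ) : ℂ) = (pairingSign hM hM' e : ℂ) := rfl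
  rw [h1, h2, pairedVector]
  congr 1
  push_cast
  ring

/-- The pairing with the spectators in standard position is the contraction of the kernels. -/
theorem pairedVector_matchingEquiv {C r : ℕ} (p : Fin C ↪ Fin nB) (p' : Fin C ↪ Fin mA)
    (h : mA - C + r = kB) (h' : nB - C + r = kA) (h1 : nB - C + nA + r = N)
    (h2 : mA - C + mB + r = N') :
    pairedVector μ hN hN' fA fB ψ (matchingEquiv p p' h h') =
      antisymmetrizer μ N (reindex μ (revFirst h1) (contract μ (contractedKernel μ fA fB p p')
        (reindex μ (revFirst h2).symm (ψ : L2 μ (Fin N'))))) := by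
  let a : Fin nA ⊕ Fin (nB - C) ≃ Fin (nB - C + nA) := (Equiv.sumComm _ _).trans finSumFinEquiv
  let b : Fin (mA - C) ⊕ Fin mB ≃ Fin (mA - C + mB) := finSumFinEquiv
  -- Relabelling of the variables of `ψ`, of the spectators, and of the created variables.
  have e1 : reindex μ (revFirst h2).symm (ψ : L2 μ (Fin N')) =
      reindex μ (b.sumCongr (Equiv.refl _)) (reindex μ
        ((revFirst h2).symm.trans (b.sumCongr (Equiv.refl _)).symm) (ψ : L2 μ (Fin N'))) := by
    rw [reindex_reindex, Equiv.trans_assoc, Equiv.symm_trans_self, Equiv.trans_refl]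
  have e2 : ((revFirst h2).symm.trans (b.sumCongr (Equiv.refl (Fin r))).symm).trans
      (((Equiv.sumComm (Fin (mA - C)) (Fin mB)).sumCongr (Equiv.refl (Fin r))).trans
        (Equiv.sumAssoc (Fin mB) (Fin (mA - C)) (Fin r))) =
      (revFirst hN').symm.trans ((Equiv.refl _).sumCongr (revFirst h).symm) := by
    have s1 : ∀ j, (revFirst h2).symm (revFirst hN' (.inl j)) = .inl (b (.inr j)) := fun j => by
      rw [Equiv.symm_apply_eq, Fin.ext_iff, revFirst_inl, revFirst_inl]
      simp [b]
      omega
    have s2 : ∀ i, (revFirst h2).symm (revFirst hN' (.inr (revFirst h (.inl i)))) =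
        .inl (b (.inl i)) := fun i => by
      rw [Equiv.symm_apply_eq, Fin.ext_iff, revFirst_inr, revFirst_inl, revFirst_inl]
      simp [b]
      omega
    have s3 : ∀ l, (revFirst h2).symm (revFirst hN' (.inr (revFirst h (.inr l)))) =
        .inr l := fun l => by
      rw [Equiv.symm_apply_eq, Fin.ext_iff, revFirst_inr, revFirst_inr, revFirst_inr]
      omega
    refine Equiv.ext fun x => ?_
    obtain ⟨x, rfl⟩ := (revFirst hN').surjective x
    rcases x with j | i
    · simp [s1]
    · obtain ⟨i, rfl⟩ := (revFirst h).surjective i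
      rcases i with i | l
      · simp [s2]
      · simp [s3]
  have e3 : (((legSplit p).symm.trans (Equiv.sumComm (Fin (nB - C)) (Fin C))).sumCongr
      (revFirst h).symm).trans ((Equiv.sumSumSumComm (Fin C) (Fin (nB - C)) (Fin (mA - C))
        (Fin r)).trans ((Equiv.sumComm (Fin C) (Fin (mA - C))).sumCongr (Equiv.refl _))) =
      (matchingEquiv p p' h h').trans ((legSplit p').symm.sumCongr (revFirst h').symm) := by
    refine Equiv.ext fun x => ?_
    rcases x with i | j
    · obtain ⟨i, rfl⟩ := (legSplit p).surjective i
      rcases i with i | i <;> simp [matchingEquiv, swapUncontracted]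
    · obtain ⟨j, rfl⟩ := (revFirst h).surjective j
      rcases j with j | j <;> simp [matchingEquiv, swapUncontracted]
  have e4 : ((Equiv.refl (Fin nA)).sumCongr (revFirst h').symm).trans
      ((Equiv.sumAssoc (Fin nA) (Fin (nB - C)) (Fin r)).symm.trans
        ((a.sumCongr (Equiv.refl (Fin r))).trans (revFirst h1))) = revFirst hN := by
    refine Equiv.ext fun x => ?_
    rcases x with i | j
    · ext
      simp [a, revFirst_inl]
      omega
    · obtain ⟨j, rfl⟩ := (revFirst h').surjective j
      ext
      rcases j with j | j <;> simp [a, revFirst_inl, revFirst_inr]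
      · omega
      · omega
  rw [e1, contractedKernel, ← reindex_reindex, contract_reindex, contract_assoc]
  simp only [reindex_reindex]
  rw [e2, ← reindex_reindex μ (revFirst hN').symm]
  simp only [Equiv.trans_assoc, Equiv.symm_trans_self, Equiv.self_trans_symm, Equiv.trans_refl]
  rw [contract_reindex, reindex_reindex, e3, ← reindex_reindex μ (matchingEquiv p p' h h'),
    contract_reindex, reindex_reindex]
  exact (congrArg (fun e => antisymmetrizer μ N (reindex μ e _)) e4).symm

open Classical in
/-- The bijections with a given matching contribute the normal ordered operator of the contracted
kernels. -/
theorem sum_matches_pairedVector {C r : ℕ} (p : Fin C ↪ Fin nB) (p' : Fin C ↪ Fin mA)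
    (h : mA - C + r = kB) (h' : nB - C + r = kA) (h1 : nB - C + nA + r = N)
    (h2 : mA - C + mB + r = N') :
    (((√(N.descFactorial nA) * √(M.descFactorial mA) * √(M.descFactorial nB) *
      √(N'.descFactorial mB) / M.factorial : ℝ)) : ℂ) •
      ∑ e, (if Matches e p p' then
        (pairingSign hM hM' e : ℂ) • pairedVector μ hN hN' fA fB ψ e else 0) =
    contractionSign p p' • (creators μ h1 (contract μ (contractedKernel μ fA fB p p')
      (annihilators μ h2 ψ)) : L2 μ (Fin N)) := by
  have key := sum_matches p p' h h'
    (fun e => (pairingSign hM hM' e : ℂ) • pairedVector μ hN hN' fA fB ψ e)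
    (fun e σ => by
      rw [pairingSign_perm_trans, pairedVector_perm_trans, smul_smul, Int.cast_mul, mul_right_comm,
        sign_mul_self_complex, one_mul])
    (fun e σ => by
      rw [pairingSign_trans, pairedVector_trans, smul_smul, Int.cast_mul, mul_right_comm,
        sign_mul_self_complex, one_mul])
  have hr : (r.factorial : ℂ) ≠ 0 := by exact_mod_cast r.factorial_ne_zero
  have hnorm := congrArg (fun x : ℝ => (x : ℂ)) (normalization hN hM' hM hN' h1 h2)
  rw [pairingSign, sign_matchingEquiv, pairedVector_matchingEquiv μ hN hN' fA fB ψ p p' h h' h1 h2,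
    ← Nat.cast_smul_eq_nsmul ℂ, ← Nat.cast_smul_eq_nsmul ℂ] at key
  rw [coe_creators, annihilators_apply, ← Int.cast_smul_eq_zsmul ℂ]
  simp only [map_smul, smul_smul]
  refine smul_right_injective _ hr ?_
  simp only
  rw [smul_comm, key, smul_smul, smul_smul, smul_smul]
  refine congrArg₂ (· • ·) ?_ rfl
  push_cast at hnorm ⊢
  linear_combination (contractionSign p p' : ℂ) * hnorm

theorem annihilators_sector {m k N : ℕ} (h : m + k = N) (Ψ : finiteParticle μ) :
    annihilators μ (rfl : m + k = m + k) (sector μ (m + k) Ψ) =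
      annihilators μ h (sector μ N Ψ) := by
  subst h
  rfl

theorem sector_normalOrdered {n m : ℕ} (f : L2 μ (Fin n ⊕ Fin m)) (N : ℕ) (Ψ : finiteParticle μ) :
    sector μ N (normalOrdered μ f Ψ) = normalOrderedSector μ f N Ψ := rfl

/-- The definition of `normalOrderedSector` with the numbers of particles as free variables. -/
theorem normalOrderedSector_eq {n m k N M : ℕ} (f : L2 μ (Fin n ⊕ Fin m)) (hN : n + k = N)
    (hM : m + k = M) (Ψ : finiteParticle μ) :
    normalOrderedSector μ f N Ψ =
      creators μ hN (contract μ f (annihilators μ hM (sector μ M Ψ))) := by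
  obtain rfl : k = N - n := by omega
  rw [normalOrderedSector, dif_pos (show n ≤ N by omega), ← annihilators_sector μ hM]
  rfl

theorem normalOrderedSector_of_lt {n m N : ℕ} (f : L2 μ (Fin n ⊕ Fin m)) (hN : N < n)
    (Ψ : finiteParticle μ) : normalOrderedSector μ f N Ψ = 0 := by
  simp [normalOrderedSector, show ¬ n ≤ N by omega]

theorem finiteParticle_ext {Ψ Φ : finiteParticle μ} (h : ∀ N, sector μ N Ψ = sector μ N Φ) :
    Ψ = Φ :=
  Subtype.ext (lp.ext (funext h))

open Classical in
/-- Wick's theorem for the product of two normal ordered operators. -/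
theorem normalOrdered_mul (fA : L2 μ (Fin nA ⊕ Fin mA)) (fB : L2 μ (Fin nB ⊕ Fin mB)) :
    normalOrdered μ fA * normalOrdered μ fB = ∑ C ∈ Finset.range (min mA nB + 1),
      ∑ p : {p : Fin C ↪ Fin nB // StrictAnti p}, ∑ p' : Fin C ↪ Fin mA,
        contractionSign p.1 p' • normalOrdered μ (contractedKernel μ fA fB p.1 p') := by
  refine LinearMap.ext fun Ψ => finiteParticle_ext μ fun N => ?_
  simp only [Module.End.mul_apply, LinearMap.sum_apply, LinearMap.smul_apply, map_sum,
    map_zsmul, sector_normalOrdered]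
  rcases lt_or_ge N nA with hlt | hge
  · rw [normalOrderedSector_of_lt μ fA hlt]
    refine (Finset.sum_eq_zero fun C _ => Finset.sum_eq_zero fun p _ =>
      Finset.sum_eq_zero fun p' _ => ?_).symm
    rw [normalOrderedSector_of_lt μ _ (by omega), smul_zero]
  obtain ⟨kA, hN⟩ := Nat.exists_eq_add_of_le hge
  obtain ⟨M, hM'⟩ : ∃ M, mA + kA = M := ⟨_, rfl⟩
  rw [normalOrderedSector_eq μ fA hN.symm hM', sector_normalOrdered]
  rcases lt_or_ge M nB with hlt' | hge'
  · rw [normalOrderedSector_of_lt μ fB hlt', map_zero, map_zero, map_zero]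
    refine (Finset.sum_eq_zero fun C _ => Finset.sum_eq_zero fun p _ =>
      Finset.sum_eq_zero fun p' _ => ?_).symm
    have : C ≤ mA := by simpa using Fintype.card_le_of_embedding p'
    rw [normalOrderedSector_of_lt μ _ (by omega), smul_zero]
  obtain ⟨kB, hM⟩ := Nat.exists_eq_add_of_le hge'
  obtain ⟨N', hN'⟩ : ∃ N', mB + kB = N' := ⟨_, rfl⟩
  rw [normalOrderedSector_eq μ fB hM.symm hN']
  refine Subtype.ext ?_
  rw [coe_creators_annihilators_creators μ hN.symm hN' hM.symm hM', sum_eq_sum_matches]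
  simp only [Finset.smul_sum, Submodule.coe_sum]
  refine Finset.sum_congr rfl fun C _ => Finset.sum_congr rfl fun p _ =>
    Finset.sum_congr rfl fun p' _ => ?_
  have hCm : C ≤ mA := by simpa using Fintype.card_le_of_embedding p'
  have hCn : C ≤ nB := by simpa using Fintype.card_le_of_embedding p.1
  rw [← Finset.smul_sum]
  rcases lt_or_ge kA (nB - C) with hlt | hge
  · rw [normalOrderedSector_of_lt μ _ (by omega), smul_zero, Finset.sum_eq_zero, smul_zero]
    · rfl
    · exact fun e _ => if_neg fun h => by have := le_of_matches h; omega
  · obtain ⟨r, hr⟩ := Nat.exists_eq_add_of_le hge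
    rw [sum_matches_pairedVector μ hN.symm hN' hM.symm hM' fA fB (sector μ N' Ψ) p.1 p' (r := r)
      (by omega) (by omega) (by omega) (by omega), normalOrderedSector_eq μ
        (contractedKernel μ fA fB p.1 p') (k := r) (M := N') (by omega) (by omega)]
    rfl

end Wick

/-! ### The uncontracted term -/

section Uncontracted
variable {X : Type*} [MeasurableSpace X] (μ : Measure X) [SigmaFinite μ]

/-- Permuting the creation variables, or the annihilation variables, of a normal ordered operator
multiplies it by the sign of the permutation. -/
theorem normalOrdered_reindex_perm {n m : ℕ} (σ : Equiv.Perm (Fin n)) (τ : Equiv.Perm (Fin m))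
    (f : L2 μ (Fin n ⊕ Fin m)) :
    normalOrdered μ (reindex μ (σ.sumCongr τ) f) =
      ((Equiv.Perm.sign σ : ℤ) * (Equiv.Perm.sign τ : ℤ)) • normalOrdered μ f := by
  refine LinearMap.ext fun Ψ => finiteParticle_ext μ fun N => ?_
  rw [LinearMap.smul_apply, map_zsmul, sector_normalOrdered, sector_normalOrdered]
  rcases lt_or_ge N n with hlt | hge
  · rw [normalOrderedSector_of_lt μ _ hlt, normalOrderedSector_of_lt μ _ hlt, smul_zero]
  obtain ⟨k, hN⟩ := Nat.exists_eq_add_of_le hge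
  have hN := hN.symm
  rw [normalOrderedSector_eq μ _ hN rfl, normalOrderedSector_eq μ _ hN rfl]
  set ψ := sector μ (m + k) Ψ
  have hτ : annihilators μ rfl ψ = ((Equiv.Perm.sign τ : ℤ) : ℂ) •
      reindex μ (τ.sumCongr (Equiv.refl (Fin k))) (annihilators μ rfl ψ) := by
    have hs : Equiv.Perm.sign ((revFirst (rfl : m + k = m + k)).symm.trans
        (Equiv.trans (Equiv.Perm.sumCongr τ 1) (revFirst rfl))) = Equiv.Perm.sign τ := by
      rw [sign_conj, Equiv.Perm.sign_sumCongr, Equiv.Perm.sign_one, mul_one]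
    have key : reindex μ (τ.sumCongr (Equiv.refl (Fin k)))
        (reindex μ (revFirst rfl).symm (ψ : L2 μ (Fin (m + k)))) =
        ((Equiv.Perm.sign τ : ℤ) : ℂ) • reindex μ (revFirst rfl).symm
          (ψ : L2 μ (Fin (m + k))) := by
      rw [← hs, ← map_smul, ← reindex_fermionSector, reindex_reindex, reindex_reindex]
      refine congrArg (fun e => reindex μ e (ψ : L2 μ (Fin (m + k)))) ?_
      rw [Equiv.trans_assoc, Equiv.trans_assoc, Equiv.self_trans_symm, Equiv.trans_refl]
      rfl
    rw [annihilators_apply, map_smul, key, smul_comm]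
    congr 1
    rw [smul_smul, sign_mul_self_complex, one_smul]
  have hσ : ∀ φ : L2 μ (Fin n ⊕ Fin k), creators μ hN
      (reindex μ (σ.sumCongr (Equiv.refl (Fin k))) φ) =
        ((Equiv.Perm.sign σ : ℤ) : ℂ) • creators μ hN φ := by
    intro φ
    have hs : Equiv.Perm.sign ((revFirst hN).symm.trans
        (Equiv.trans (Equiv.Perm.sumCongr σ 1) (revFirst hN))) = Equiv.Perm.sign σ := by
      rw [sign_conj, Equiv.Perm.sign_sumCongr, Equiv.Perm.sign_one, mul_one]
    refine Subtype.ext ?_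
    rw [Submodule.coe_smul, coe_creators, coe_creators, smul_comm, ← hs,
      ← antisymmetrizer_reindex, reindex_reindex, reindex_reindex]
    refine congrArg (fun e => _ • antisymmetrizer μ N (reindex μ e φ)) ?_
    rw [← Equiv.trans_assoc, Equiv.self_trans_symm, Equiv.refl_trans]
    rfl
  conv_lhs => rw [hτ]
  rw [map_smul, map_smul, contract_reindex, hσ, smul_smul, mul_comm, ← Int.cast_mul,
    Int.cast_smul_eq_zsmul]

theorem normalOrdered_reindex {n n' m m' : ℕ} (σ : Fin n ≃ Fin n') (τ : Fin m ≃ Fin m')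
    (hn : n' = n) (hm : m' = m) (f : L2 μ (Fin n ⊕ Fin m)) :
    normalOrdered μ (reindex μ (σ.sumCongr τ) f) =
      ((Equiv.Perm.sign (σ.trans (finCongr hn)) : ℤ) *
        (Equiv.Perm.sign (τ.trans (finCongr hm)) : ℤ)) • normalOrdered μ f := by
  subst hn hm
  exact normalOrdered_reindex_perm μ σ τ f

/-- Without contractions all connectors are uncontracted; the type of the right-hand side uses that
`n - 0` reduces to `n`. -/
theorem legSplit_symm_zero {n : ℕ} (p : Fin 0 ↪ Fin n) (i : Fin n) :
    (legSplit p).symm i = .inl i := by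
  rw [Equiv.symm_apply_eq, Subsingleton.elim p (maximalCrossing (Nat.zero_le n)), Fin.ext_iff,
    legSplit_maximalCrossing_inl]

theorem contractionSign_zero {n m : ℕ} (p : Fin 0 ↪ Fin n) (p' : Fin 0 ↪ Fin m) :
    contractionSign p p' = (-1) ^ (m * n) := by
  have h : ∀ {n : ℕ} (p : Fin 0 ↪ Fin n), crossingPerm p = 1 := fun {n} p => by
    rw [crossingPerm, Subsingleton.elim (maximalCrossing _) p, Equiv.symm_trans_self]
    rfl
  simp [contractionSign, h]

theorem reindex_contract_congr {α β γ κ : Type*} [Fintype α] [Fintype β] [Fintype γ] [Fintype κ]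
    {e e' : α ⊕ β ≃ κ} {F F' : L2 μ (α ⊕ γ)} {G G' : L2 μ (γ ⊕ β)} (he : e = e') (hF : F = F')
    (hG : G = G') : reindex μ e (contract μ F G) = reindex μ e' (contract μ F' G') := by
  rw [he, hF, hG]

/-- Without contractions, the kernels of both orders of the product differ by exchanging the
variables of the two factors. -/
theorem contractedKernel_zero_comm {nA mA nB mB : ℕ} (fA : L2 μ (Fin nA ⊕ Fin mA))
    (fB : L2 μ (Fin nB ⊕ Fin mB)) (p : Fin 0 ↪ Fin nB) (p' : Fin 0 ↪ Fin mA) (q : Fin 0 ↪ Fin nA)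
    (q' : Fin 0 ↪ Fin mB) :
    contractedKernel μ fB fA q q' = reindex μ
      ((finAddFlip : Fin (nB - 0 + nA) ≃ Fin (nA - 0 + nB)).sumCongr
        (finAddFlip : Fin (mA - 0 + mB) ≃ Fin (mB - 0 + mA))) (contractedKernel μ fA fB p p') := by
  rw [contractedKernel, contractedKernel, contract_comm μ (α := Fin nA ⊕ Fin (mA - 0))]
  simp only [reindex_reindex]
  refine reindex_contract_congr μ (Equiv.ext ?_) (congrArg (fun e => reindex μ e fB) (Equiv.ext ?_))
    (congrArg (fun e => reindex μ e fA) (Equiv.ext ?_))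
  -- All variables agree by definition of the relabellings, up to `finAddFlip` on the blocks.
  · rintro ((i | i) | (i | i))
    · exact congrArg Sum.inl (finAddFlip_apply_castAdd i nA).symm
    · exact congrArg Sum.inr (finAddFlip_apply_natAdd i mA).symm
    · exact congrArg Sum.inl (finAddFlip_apply_natAdd i nB).symm
    · exact congrArg Sum.inr (finAddFlip_apply_castAdd i mB).symm
  · rintro (i | i)
    · exact (congrArg (fun y => Equiv.sumComm (Fin 0) (Fin nB ⊕ Fin mB) (Equiv.sumAssoc (Fin 0)
        (Fin nB) (Fin mB) (.inl (Equiv.sumComm _ _ y)))) (legSplit_symm_zero p i)).symm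
    · exact congrArg (fun y => (Equiv.sumAssoc (Fin nB) (Fin mB) (Fin 0)).symm (.inr y))
        (legSplit_symm_zero q' i)
  · rintro (i | i)
    · exact congrArg (fun y => Equiv.sumAssoc (Fin 0) (Fin nA) (Fin mA)
        (.inl (Equiv.sumComm _ _ y))) (legSplit_symm_zero q i)
    · exact (congrArg (fun y => Equiv.sumComm (Fin nA ⊕ Fin mA) (Fin 0) ((Equiv.sumAssoc (Fin nA)
        (Fin mA) (Fin 0)).symm (.inr y))) (legSplit_symm_zero p' i)).symm

theorem normalOrdered_contractedKernel_zero_comm {nA mA nB mB : ℕ} (fA : L2 μ (Fin nA ⊕ Fin mA))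
    (fB : L2 μ (Fin nB ⊕ Fin mB)) (p : Fin 0 ↪ Fin nB) (p' : Fin 0 ↪ Fin mA) (q : Fin 0 ↪ Fin nA)
    (q' : Fin 0 ↪ Fin mB) :
    normalOrdered μ (contractedKernel μ fB fA q q') =
      (-1 : ℤ) ^ (nB * nA + mA * mB) • normalOrdered μ (contractedKernel μ fA fB p p') := by
  rw [contractedKernel_zero_comm μ fA fB p p' q q',
    normalOrdered_reindex μ _ _ (Nat.add_comm _ _) (Nat.add_comm _ _)]
  have h1 := congrArg Units.val (sign_blockSwap nB nA)
  have h2 := congrArg Units.val (sign_blockSwap mA mB)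
  push_cast at h1 h2
  rw [pow_add, ← h1, ← h2]
  rfl

/-- Wick's theorem, with the uncontracted term separated. -/
theorem normalOrdered_mul_eq {nA mA nB mB : ℕ} (fA : L2 μ (Fin nA ⊕ Fin mA))
    (fB : L2 μ (Fin nB ⊕ Fin mB)) (p : Fin 0 ↪ Fin nB) (p' : Fin 0 ↪ Fin mA) :
    normalOrdered μ fA * normalOrdered μ fB = (-1 : ℤ) ^ (mA * nB) •
      normalOrdered μ (contractedKernel μ fA fB p p') + attachedProduct μ fA fB := by
  classical
  rw [normalOrdered_mul, show Finset.range (min mA nB + 1) = insert 0 (Finset.Icc 1 (min mA nB)) by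
    ext; simp; omega, Finset.sum_insert (by simp)]
  refine congrArg₂ (· + ·) ?_ rfl
  rw [Fintype.sum_subsingleton _ ⟨p, Subsingleton.strictAnti p⟩, Fintype.sum_subsingleton _ p',
    contractionSign_zero]

end Uncontracted

end FermionFock

end

theorem theorem2 {X : Type*} [MeasurableSpace X] (μ : Measure X) [SigmaFinite μ]
    (nA mA nB mB : ℕ) (fA : L2 μ (Fin nA ⊕ Fin mA)) (fB : L2 μ (Fin nB ⊕ Fin mB)) :
    (Even ((nA + mA) * (nB + mB)) →
      normalOrdered μ fA * normalOrdered μ fB - normalOrdered μ fB * normalOrdered μ fA =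
        attachedProduct μ fA fB - attachedProduct μ fB fA) ∧
    (Odd ((nA + mA) * (nB + mB)) →
      normalOrdered μ fA * normalOrdered μ fB + normalOrdered μ fB * normalOrdered μ fA =
        attachedProduct μ fA fB + attachedProduct μ fB fA) := by
  have e : ∀ n, Fin 0 ↪ Fin n := fun n => Function.Embedding.ofIsEmpty
  have hAB := normalOrdered_mul_eq μ fA fB (e nB) (e mA)
  have hBA := normalOrdered_mul_eq μ fB fA (e nA) (e mB)
  rw [normalOrdered_contractedKernel_zero_comm μ fA fB (e nB) (e mA), smul_smul, ← pow_add] at hBA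
  -- The uncontracted terms of the two orders differ by the sign `(-1) ^ ((nA + mA) * (nB + mB))`.
  have hsign : (-1 : ℤ) ^ (mA * nB) =
      (-1) ^ ((nA + mA) * (nB + mB)) * (-1) ^ (mB * nA + (nB * nA + mA * mB)) := by
    rw [← pow_add, show (nA + mA) * (nB + mB) + (mB * nA + (nB * nA + mA * mB)) =
      mA * nB + 2 * (nA * nB + nA * mB + mA * mB) by ring, pow_add, pow_mul]
    simp
  rw [hAB, hBA, hsign]
  constructor <;> intro h
  · rw [h.neg_one_pow, one_mul]
    abel
  · rw [h.neg_one_pow, neg_one_mul, neg_smul]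
    abel
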